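/- For a finite simple graph $G=(V,E)$, let $(X_t)_{t\ge 0}$ be the interchange process on $G$: the continuous-time Markov chain on the permutations of $V$ with $X_0=\mathrm{id}$ that jumps from $\sigma$ to $\tau_{\{x,y\}}\sigma$ at rate $1$ for each edge $\{x,y\}\in E$, where $\tau_{\{x,y\}}$ is the transposition of $x$ and $y$. Let $N(\sigma)$ be the number of cycles of $\sigma$ (fixed points included). For $\theta>0$ put $Z_\theta(t)=\mathbb E\big(\theta^{N(X_t)}\big)$ and $\mathbb P_{\theta,t}(A)=\frac{1}{Z_\theta(t)}\mathbb E\big(\theta^{N(X_t)}1_A\big)$ for events $A$ that depend on $X_t$. For $\eta>0$ let $A_\eta$ be the event that $X_t$ has a cycle of size larger than $\eta|V|$. Let $p_{d,n}$ be the uniform probability measure on the $d$-regular simple graphs with vertex set $\{1,\dots,n\}$; limits $n\to\infty$ are taken along the $n$ with $nd$ even. For $\theta>0$ and $d>2(1+\theta)$ put $$T(\theta,d)=\frac{2\theta\log\theta}{(\theta-1)(d-2(1+\theta))}\ \text{ if }\theta\neq 1,\qquad T(1,d)=\frac{2}{d-4}.$$ **Theorem.** Let $\theta\in(0,\infty)$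 and let $d$ be an integer with $d>2(1+\theta)$. (i) For every $\epsilon\in\left(0,\frac{d-2}{2}\right)$ there exists $\eta>0$ such that for all $b\ge a\ge 0$: $$p_{d,n}\left(\int_a^b\mathbb P_{\theta,t}(A_\eta)\,dt\ \ge\ \frac{(b-a)\left(\frac d2-(\theta+1)(1+\epsilon)\right)-T(\theta,d)\left(\frac d2-(1+\theta)\right)}{(1+\theta)\left(\frac d2-(1+\epsilon)\right)}\right)\xrightarrow[n\to\infty]{}1.$$ (ii) For every $\delta>0$ there exist $\eta,c>0$ such that for all $a\ge 0$: $$p_{d,n}\left(\exists\, t\in[a,a+T(\theta,d)+\delta]\ \text{ such that }\ \mathbb P_{\theta,t}(A_\eta)\ge c\right)\xrightarrow[n\to\infty]{}1.$$ -/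

import Mathlib

open Filter Topology

noncomputable section

namespace Interchange

variable {V : Type*} [Fintype V] [DecidableEq V]

/-- The transposition `τ_e` exchanging the two endpoints of the unordered pair `e`
(the identity if the two endpoints coincide). -/
def transposition (e : Sym2 V) : Equiv.Perm V :=
  Sym2.lift ⟨fun x y => Equiv.swap x y, fun x y => Equiv.swap_comm x y⟩ e

/-- The size of the cycle of `σ` that contains `x` (it is `1` if `x` is a fixed point). -/
def cycleSize (σ : Equiv.Perm V) (x : V) : ℕ :=
  Nat.card {y : V // σ.SameCycle x y}

/-- `N(σ)`, the number of cycles of `σ`, fixed points counted as cycles of size `1`. -/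
def numCycles (σ : Equiv.Perm V) : ℕ :=
  Nat.card (Quotient (Equiv.Perm.SameCycle.setoid σ))

/-- `A_η`: there is a cycle of size larger than `η |V|`. -/
def HasMacroscopicCycle (η : ℝ) (σ : Equiv.Perm V) : Prop :=
  ∃ x : V, η * (Fintype.card V : ℝ) < (cycleSize σ x : ℝ)

open Classical in
/-- The generator (matrix of jump rates) of the interchange process on the graph `G`: for each edge
`e` of `G`, at rate `1`, the process jumps from `σ` to `τ_e * σ`. As an operator on functions,
`(Q f) σ = ∑ e ∈ E, (f (τ_e * σ) - f σ)`. -/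
def generator (G : SimpleGraph V) : Matrix (Equiv.Perm V) (Equiv.Perm V) ℝ :=
  Matrix.of fun σ σ' =>
    ∑ e : Sym2 V with e ∈ G.edgeSet,
      ((if σ' = transposition e * σ then (1 : ℝ) else 0) - (if σ' = σ then (1 : ℝ) else 0))

/-- The transition semigroup `exp (t Q)` of the interchange process: the entry at `(σ, σ')` is the
probability to be in state `σ'` at time `s + t` when the state at time `s` is `σ`. -/
def transition (G : SimpleGraph V) (t : ℝ) : Matrix (Equiv.Perm V) (Equiv.Perm V) ℝ :=
  NormedSpace.exp (t • generator G)

/-- The law of the interchange process `X_t`, started at `X_0 = id`, at the time `t`. -/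
def law (G : SimpleGraph V) (t : ℝ) (σ : Equiv.Perm V) : ℝ :=
  transition G t 1 σ

/-- The expectation `E (f (X_t))`. -/
def expect (G : SimpleGraph V) (t : ℝ) (f : Equiv.Perm V → ℝ) : ℝ :=
  ∑ σ : Equiv.Perm V, law G t σ * f σ

/-- The partition function `Z_θ(t) = E (θ ^ N(X_t))`. -/
def partitionFunction (G : SimpleGraph V) (θ t : ℝ) : ℝ :=
  expect G t fun σ => θ ^ numCycles σ

open Classical in
/-- The weighted probability `P_{θ,t}(A) = E (θ ^ N(X_t) 1_A) / Z_θ(t)`. -/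
def prob (G : SimpleGraph V) (θ t : ℝ) (A : Equiv.Perm V → Prop) : ℝ :=
  expect G t (fun σ => θ ^ numCycles σ * (if A σ then 1 else 0)) / partitionFunction G θ t

/-- The time `T(θ, d)`. -/
def criticalTime (θ : ℝ) (d : ℕ) : ℝ :=
  if θ = 1 then 2 / ((d : ℝ) - 4)
  else 2 * θ * Real.log θ / ((θ - 1) * ((d : ℝ) - 2 * (1 + θ)))

open Classical in
/-- The set of (simple, labelled) `d`-regular graphs on the vertex set `Fin n`. -/
def regularGraphs (d n : ℕ) : Finset (SimpleGraph (Fin n)) :=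
  Finset.univ.filter fun G => G.IsRegularOfDegree d

open Classical in
/-- `p_{d,n}(P)`: the probability that a uniformly random `d`-regular graph on `n` vertices has
the property `P` (meaningful when such a graph exists). -/
def regularGraphProb (d n : ℕ) (P : SimpleGraph (Fin n) → Prop) : ℝ :=
  (((regularGraphs d n).filter P).card : ℝ) / ((regularGraphs d n).card : ℝ)

/-- `n → ∞` along the integers `n` with `n * d` even; for large `n` these are exactly the `n` for
which there is a `d`-regular graph on `n` vertices. -/
def atTopEven (d : ℕ) : Filter ℕ :=
  atTop ⊓ 𝓟 {n : ℕ | Even (n * d)}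

end Interchange

end

noncomputable section

namespace Interchange

/-! Multiplying by a transposition whose two points share a cycle splits that cycle; otherwise it
merges two cycles. Hence, with `K(σ)` the number of edges joining points of a common cycle of `σ`,
the generator sends `θ ^ N` to `θ ^ N * ((θ - θ⁻¹) K + (θ⁻¹ - 1) |E|)`, and `log Z_θ` has derivative
`(θ - θ⁻¹) 𝔼_θ[K] + (θ⁻¹ - 1) |E|`. But `log Z_θ` always lies between `0` and `|V| log θ`, so the
time integral of `𝔼_θ[K]` over `[a, b]` is at least `(|E| (b - a) - |V| κ) / (1 + θ)`, where `κ = θ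
log θ / (θ - 1)`. For `θ = 1` the mean of `N` replaces `log Z_θ`, and `κ = 1`
(`le_integral_meanCycleEdges`).

Conversely, suppose every set of at most `η |V|` vertices spans at most `1 + ε` times as many edges
as it has vertices. Without a cycle larger than `η |V|`, summing over cycles gives `K ≤ (1 + ε)
|V|`, and always `K ≤ |E|`. So a large integral of `𝔼_θ[K]` forces a large integral of `ℙ_θ(A_η)`
(`le_integral_prob`), deterministically on such graphs.

A random regular graph has this sparsity with probability tending to `1`
(`exists_tendsto_smallSetsSparse`): a switching argument bounds the probability of containing a
given edge set `H` by `(2d/n) ^ |H|`, and a union bound over small dense vertex sets finishes. -/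

/-! ### Splitting and merging of cycles by a transposition -/

/-- The `σ`-orbit of `x` avoids `y`, so until its first return to `x` the product moves `x` exactly
as `σ` does; at that return the swap redirects it to `y`. -/
theorem sameCycle_swap_mul_of_not {V : Type*} [Fintype V] [DecidableEq V] {σ : Equiv.Perm V}
    {x y : V} (h : ¬ σ.SameCycle x y) : (Equiv.swap x y * σ).SameCycle x y := by
  classical
  have hex : ∃ k : ℕ, 0 < k ∧ (σ ^ k) x = x :=
    ⟨orderOf σ, orderOf_pos σ, by simp [pow_orderOf_eq_one]⟩
  obtain ⟨hk0, hk⟩ := Nat.find_spec hex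
  have key : ∀ j, j < Nat.find hex → ((Equiv.swap x y * σ) ^ j) x = (σ ^ j) x := by
    intro j
    induction j with
    | zero => simp
    | succ j ih =>
      intro hj
      have h1 : (σ ^ (j + 1)) x ≠ x := fun hx => Nat.find_min hex hj ⟨by omega, hx⟩
      have h2 : (σ ^ (j + 1)) x ≠ y := fun hy => h ⟨(j + 1 : ℕ), by rw [zpow_natCast]; exact hy⟩
      rw [pow_succ', Equiv.Perm.mul_apply, ih (by omega), Equiv.Perm.mul_apply,
        ← Equiv.Perm.mul_apply σ, ← pow_succ', Equiv.swap_apply_of_ne_of_ne h1 h2]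
  obtain ⟨k, hk'⟩ : ∃ k, Nat.find hex = k + 1 := ⟨Nat.find hex - 1, by omega⟩
  refine ⟨(k + 1 : ℕ), ?_⟩
  rw [zpow_natCast, pow_succ', Equiv.Perm.mul_apply, key k (by omega), Equiv.Perm.mul_apply,
    ← Equiv.Perm.mul_apply σ, ← pow_succ', ← hk', hk, Equiv.swap_apply_left]

/-- If `k` is the first time `σ` carries `x` to `y`, the swap sends this arrival back to `x`. The
points `σ ^ j x` with `j < k` are therefore closed under the product, and `y` is not among them. -/
theorem not_sameCycle_swap_mul {V : Type*} [Fintype V] [DecidableEq V] {σ : Equiv.Perm V}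
    {x y : V} (hxy : x ≠ y) (h : σ.SameCycle x y) :
    ¬ (Equiv.swap x y * σ).SameCycle x y := by
  classical
  have hex : ∃ k : ℕ, (σ ^ k) x = y := by
    obtain ⟨k, -, hk⟩ := h.exists_pow_eq'
    exact ⟨k, hk⟩
  set k := Nat.find hex with hkdef
  have hk : (σ ^ k) x = y := Nat.find_spec hex
  have hk0 : 0 < k := by
    rcases Nat.eq_zero_or_pos k with h0 | h0
    · rw [h0] at hk; exact absurd hk (by simpa using hxy)
    · exact h0
  have hmin : ∀ j, j < k → (σ ^ j) x ≠ y := fun j hj => Nat.find_min hex hj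
  have hclosed : ∀ i : ℕ, ∃ j, j < k ∧ ((Equiv.swap x y * σ) ^ i) x = (σ ^ j) x := by
    intro i
    induction i with
    | zero => exact ⟨0, hk0, by simp⟩
    | succ i ih =>
      obtain ⟨j, hj, hij⟩ := ih
      have hstep : ((Equiv.swap x y * σ) ^ (i + 1)) x = Equiv.swap x y ((σ ^ (j + 1)) x) := by
        rw [pow_succ', Equiv.Perm.mul_apply, hij, Equiv.Perm.mul_apply,
          ← Equiv.Perm.mul_apply σ, ← pow_succ']
      rcases Nat.lt_or_ge (j + 1) k with hjk | hjk
      · refine ⟨j + 1, hjk, ?_⟩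
        -- A return to `x` before time `k` would make `y` reachable in `k - (j + 1)` steps, against
        -- minimality.
        have h1 : (σ ^ (j + 1)) x ≠ x := by
          intro hx
          refine hmin (k - (j + 1)) (by omega) ?_
          rw [← hk]
          conv_rhs => rw [← Nat.sub_add_cancel hjk.le, pow_add, Equiv.Perm.mul_apply, hx]
        rw [hstep, Equiv.swap_apply_of_ne_of_ne h1 (hmin _ hjk)]
      · have hjk' : j + 1 = k := by omega
        exact ⟨0, hk0, by rw [hstep, hjk', hk, Equiv.swap_apply_right]; simp⟩
  intro hs
  obtain ⟨i, -, hi⟩ := hs.exists_pow_eq'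
  obtain ⟨j, hj, hij⟩ := hclosed i
  exact hmin j hj (hij.symm.trans hi)

theorem sameCycle_of_forall_apply {V : Type*} [Finite V] {σ : Equiv.Perm V} (r : Setoid V)
    (h : ∀ u, r u (σ u)) {u v : V} (huv : σ.SameCycle u v) : r u v := by
  obtain ⟨i, -, rfl⟩ := huv.exists_pow_eq'
  clear huv
  induction i with
  | zero => exact r.refl _
  | succ i ih =>
    rw [pow_succ', Equiv.Perm.mul_apply]
    exact r.trans ih (h _)

/-- The equivalence relation obtained from `r` by merging the classes of `x` and `y`. -/
def mergeSetoid {V : Type*} (r : Setoid V) (x y : V) : Setoid V where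
  r u v := r u v ∨ ((r u x ∨ r u y) ∧ (r v x ∨ r v y))
  iseqv :=
    { refl := fun u => Or.inl (r.refl u)
      symm := fun h => h.elim (fun h => Or.inl (r.symm h)) fun h => Or.inr h.symm
      trans := by
        rintro u v w (h | ⟨h1, h2⟩) (h' | ⟨h1', h2'⟩)
        · exact Or.inl (r.trans h h')
        · exact Or.inr ⟨h1'.imp (r.trans h) (r.trans h), h2'⟩
        · exact Or.inr ⟨h1, h2.imp (r.trans (r.symm h')) (r.trans (r.symm h'))⟩
        · exact Or.inr ⟨h1, h2'⟩ }

/-- The old classes other than that of `y` are in bijection with the merged classes. -/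
theorem card_quotient_mergeSetoid {V : Type*} [Finite V] (r : Setoid V) {x y : V}
    (hxy : ¬ r x y) : Nat.card (Quotient (mergeSetoid r x y)) + 1 = Nat.card (Quotient r) := by
  classical
  have := Fintype.ofFinite V
  have hmono : ∀ u v, r u v → mergeSetoid r x y u v := fun u v h => Or.inl h
  let f : {q : Quotient r // q ≠ Quotient.mk r y} → Quotient (mergeSetoid r x y) :=
    fun q => Quotient.map' id hmono q.1
  have hf : Function.Bijective f := by
    constructor
    · rintro ⟨q, hq⟩ ⟨q', hq'⟩ h
      induction q using Quotient.inductionOn with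
      | h u =>
      induction q' using Quotient.inductionOn with
      | h v =>
      have hu : ¬ r u y := fun h => hq (Quotient.sound h)
      have hv : ¬ r v y := fun h => hq' (Quotient.sound h)
      have huv : mergeSetoid r x y u v := Quotient.exact h
      rcases huv with h | ⟨h1, h2⟩
      · exact Subtype.ext (Quotient.sound h)
      · exact Subtype.ext (Quotient.sound
          (r.trans (h1.resolve_right hu) (r.symm (h2.resolve_right hv))))
    · intro q
      induction q using Quotient.inductionOn with
      | h u =>
      by_cases hu : r u y
      · exact ⟨⟨Quotient.mk r x, fun h => hxy (Quotient.exact h)⟩,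
          Quotient.sound (Or.inr ⟨Or.inl (r.refl x), Or.inr hu⟩)⟩
      · exact ⟨⟨Quotient.mk r u, fun h => hu (Quotient.exact h)⟩, rfl⟩
  rw [← Nat.card_congr (Equiv.ofBijective f hf), Nat.card_eq_fintype_card,
    Nat.card_eq_fintype_card, Fintype.card_subtype_compl, Fintype.card_subtype_eq]
  have : 0 < Fintype.card (Quotient r) := Fintype.card_pos_iff.mpr ⟨Quotient.mk r y⟩
  omega

/-- The cycle relation of the product is that of `σ` with the classes of `x` and `y` merged. Each
inclusion need only be checked on one application of a permutation. -/
theorem numCycles_swap_mul_of_not {V : Type*} [Fintype V] [DecidableEq V] {σ : Equiv.Perm V}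
    {x y : V} (h : ¬ σ.SameCycle x y) :
    numCycles (Equiv.swap x y * σ) + 1 = numCycles σ := by
  have hs := sameCycle_swap_mul_of_not h
  set τ := Equiv.swap x y * σ with hτ
  have hswap : ∀ (r : Setoid V), r x y → ∀ w, r w (Equiv.swap x y w) := by
    intro r hr w
    rcases eq_or_ne w x with rfl | hwx
    · simpa using hr
    rcases eq_or_ne w y with rfl | hwy
    · simpa using r.symm hr
    rw [Equiv.swap_apply_of_ne_of_ne hwx hwy]
  have hle : ∀ {u v}, σ.SameCycle u v → τ.SameCycle u v := by
    intro u v huv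
    refine sameCycle_of_forall_apply (Equiv.Perm.SameCycle.setoid τ) (fun u => ?_) huv
    have h1 : τ.SameCycle u (τ u) := ⟨1, by simp⟩
    have h2 : τ.SameCycle (τ u) (Equiv.swap x y (τ u)) :=
      hswap (Equiv.Perm.SameCycle.setoid τ) hs _
    have h3 : Equiv.swap x y (τ u) = σ u := by simp [hτ]
    rw [h3] at h2
    exact h1.trans h2
  have heq : Equiv.Perm.SameCycle.setoid τ = mergeSetoid (Equiv.Perm.SameCycle.setoid σ) x y := by
    ext u v
    constructor
    · intro huv
      refine sameCycle_of_forall_apply _ (fun u => ?_) (show τ.SameCycle u v from huv)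
      have h1 : mergeSetoid (Equiv.Perm.SameCycle.setoid σ) x y u (σ u) := Or.inl ⟨1, by simp⟩
      refine Setoid.trans' _ h1 (hswap _ (Or.inr ⟨Or.inl ?_, Or.inr ?_⟩) _)
      · exact Setoid.refl' _ _
      · exact Setoid.refl' _ _
    · have hx : ∀ u, (σ.SameCycle u x ∨ σ.SameCycle u y) → τ.SameCycle u x := fun u hu =>
        hu.elim hle fun h => (hle h).trans hs.symm
      rintro (h | ⟨h1, h2⟩)
      · exact hle h
      · exact (hx u h1).trans (hx v h2).symm
  unfold numCycles
  rw [heq]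
  exact card_quotient_mergeSetoid _ h

/-- The swap is an involution, so splitting is merging read backwards, starting from the product. -/
theorem numCycles_swap_mul_of_sameCycle {V : Type*} [Fintype V] [DecidableEq V]
    {σ : Equiv.Perm V} {x y : V} (hxy : x ≠ y) (h : σ.SameCycle x y) :
    numCycles (Equiv.swap x y * σ) = numCycles σ + 1 := by
  have := numCycles_swap_mul_of_not (not_sameCycle_swap_mul hxy h)
  rwa [Equiv.swap_mul_self_mul, eq_comm] at this

/-! ### Edges inside cycles, and sparse graphs -/

/-- Both endpoints of `e` lie in the same cycle of `σ`. -/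
def JoinsCycle {V : Type*} (σ : Equiv.Perm V) (e : Sym2 V) : Prop :=
  ∀ x ∈ e, ∀ y ∈ e, σ.SameCycle x y

theorem joinsCycle_mk {V : Type*} {σ : Equiv.Perm V} {x y : V} :
    JoinsCycle σ s(x, y) ↔ σ.SameCycle x y := by
  constructor
  · intro h
    exact h x (by simp) y (by simp)
  · intro h u hu v hv
    rw [Sym2.mem_iff] at hu hv
    rcases hu with rfl | rfl <;> rcases hv with rfl | rfl
    · exact Equiv.Perm.SameCycle.refl _ _
    · exact h
    · exact h.symm
    · exact Equiv.Perm.SameCycle.refl _ _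

theorem numCycles_transposition_mul_of_joinsCycle {V : Type*} [Fintype V] [DecidableEq V]
    {G : SimpleGraph V} {σ : Equiv.Perm V} {e : Sym2 V} (he : e ∈ G.edgeSet)
    (h : JoinsCycle σ e) : numCycles (transposition e * σ) = numCycles σ + 1 := by
  induction e using Sym2.inductionOn with
  | hf x y =>
  exact numCycles_swap_mul_of_sameCycle (G.ne_of_adj he) (joinsCycle_mk.mp h)

theorem numCycles_transposition_mul_of_not_joinsCycle {V : Type*} [Fintype V] [DecidableEq V]
    {σ : Equiv.Perm V} {e : Sym2 V} (h : ¬ JoinsCycle σ e) :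
    numCycles (transposition e * σ) + 1 = numCycles σ := by
  induction e using Sym2.inductionOn with
  | hf x y => exact numCycles_swap_mul_of_not (fun hs => h (joinsCycle_mk.mpr hs))

theorem numCycles_le_card {V : Type*} [Fintype V] (σ : Equiv.Perm V) :
    numCycles σ ≤ Fintype.card V := by
  unfold numCycles
  rw [← Nat.card_eq_fintype_card]
  exact Nat.card_le_card_of_surjective _ Quotient.mk_surjective

/-- The number of edges of `G` spanned by the cycles of `σ`. -/
def cycleEdges {V : Type*} [Fintype V] (G : SimpleGraph V) (σ : Equiv.Perm V) : ℕ :=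
  {e : Sym2 V | e ∈ G.edgeSet ∧ JoinsCycle σ e}.ncard

/-- The number of edges of `G` spanned by the vertex set `K`. -/
def spannedEdges {V : Type*} (G : SimpleGraph V) (K : Finset V) : ℕ :=
  {e : Sym2 V | e ∈ G.edgeSet ∧ ∀ x ∈ e, x ∈ K}.ncard

/-- Sets of at most `η |V|` vertices span at most `1 + ε` times as many edges as vertices. -/
def SmallSetsSparse {V : Type*} [Fintype V] (G : SimpleGraph V) (η ε : ℝ) : Prop :=
  ∀ K : Finset V, (K.card : ℝ) ≤ η * Fintype.card V →
    (spannedEdges G K : ℝ) ≤ (1 + ε) * K.card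

theorem cycleEdges_le_ncard_edgeSet {V : Type*} [Fintype V] (G : SimpleGraph V)
    (σ : Equiv.Perm V) : cycleEdges G σ ≤ G.edgeSet.ncard :=
  Set.ncard_le_ncard (fun _ h => h.1) (Set.toFinite _)

/-- The cycles partition the vertices into sets small enough for sparsity, and each counted edge
lies inside one of them; the bounds add up. -/
theorem cycleEdges_le_of_smallSetsSparse {V : Type*} [Fintype V] [DecidableEq V]
    {G : SimpleGraph V} {η ε : ℝ} (hG : SmallSetsSparse G η ε) {σ : Equiv.Perm V}
    (hσ : ¬ HasMacroscopicCycle η σ) : (cycleEdges G σ : ℝ) ≤ (1 + ε) * Fintype.card V := by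
  classical
  let r := Equiv.Perm.SameCycle.setoid σ
  let K : Quotient r → Finset V := fun q => Finset.univ.filter fun x => Quotient.mk r x = q
  have hcard : ∀ q, ((K q).card : ℝ) ≤ η * Fintype.card V := by
    intro q
    induction q using Quotient.inductionOn with
    | h x =>
    have hx : ¬ η * (Fintype.card V : ℝ) < (cycleSize σ x : ℝ) := fun h => hσ ⟨x, h⟩
    rw [not_lt] at hx
    convert! hx using 2
    unfold cycleSize
    rw [Nat.card_eq_fintype_card, Fintype.card_subtype]
    congr 1
    ext y
    simp only [K, Finset.mem_filter, Finset.mem_univ, true_and]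
    exact ⟨fun h => (Equiv.Perm.SameCycle.symm (Quotient.exact h)),
      fun h => Quotient.sound (Equiv.Perm.SameCycle.symm h)⟩
  have hsub : {e : Sym2 V | e ∈ G.edgeSet ∧ JoinsCycle σ e} ⊆
      ⋃ q ∈ (Finset.univ : Finset (Quotient r)),
        {e : Sym2 V | e ∈ G.edgeSet ∧ ∀ x ∈ e, x ∈ K q} := by
    rintro e ⟨he, hj⟩
    induction e using Sym2.inductionOn with
    | hf x y =>
    simp only [Set.mem_iUnion]
    refine ⟨Quotient.mk r x, Finset.mem_univ _, he, fun z hz => ?_⟩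
    simp only [K, Finset.mem_filter, Finset.mem_univ, true_and]
    exact Quotient.sound (hj z hz x (by simp))
  have h1 : cycleEdges G σ ≤ ∑ q : Quotient r, spannedEdges G (K q) :=
    (Set.ncard_le_ncard hsub (Set.toFinite _)).trans (Finset.set_ncard_biUnion_le _ _)
  have h2 : (Fintype.card V : ℝ) = ∑ q : Quotient r, ((K q).card : ℝ) := by
    rw [← Finset.card_univ, Finset.card_eq_sum_card_fiberwise
      (f := fun x : V => Quotient.mk r x) (t := Finset.univ) (fun _ _ => by simp)]
    push_cast
    rfl
  calc (cycleEdges G σ : ℝ) ≤ ∑ q : Quotient r, (spannedEdges G (K q) : ℝ) := by exact_mod_cast h1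
    _ ≤ ∑ q : Quotient r, (1 + ε) * ((K q).card : ℝ) :=
        Finset.sum_le_sum fun q _ => hG _ (hcard q)
    _ = (1 + ε) * Fintype.card V := by rw [h2, Finset.mul_sum]

/-! ### The semigroup and its expectations -/

open scoped Matrix.Norms.Operator

theorem exp_apply_nonneg {ι : Type*} [Fintype ι] [DecidableEq ι] {A : Matrix ι ι ℝ}
    (hA : ∀ i j, 0 ≤ A i j) (i j : ι) : 0 ≤ NormedSpace.exp A i j := by
  have hpow : ∀ (n : ℕ) (i j : ι), 0 ≤ (A ^ n) i j := by
    intro n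
    induction n with
    | zero =>
      intro i j
      rw [pow_zero, Matrix.one_apply]
      split_ifs <;> norm_num
    | succ n ih =>
      intro i j
      rw [pow_succ, Matrix.mul_apply]
      exact Finset.sum_nonneg fun k _ => mul_nonneg (ih i k) (hA k j)
  have h := NormedSpace.exp_series_hasSum_exp' (𝕂 := ℝ) A
  have h' : HasSum (fun n : ℕ => ((n.factorial : ℝ)⁻¹ • A ^ n) i j) (NormedSpace.exp A i j) := by
    have hc : Continuous fun M : Matrix ι ι ℝ => M i j := by fun_prop
    exact h.map (Matrix.entryAddMonoidHom ℝ i j) hc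
  exact h'.nonneg fun n => mul_nonneg (by positivity) (hpow n i j)

section Semigroup

variable {V : Type*} [Fintype V] [DecidableEq V] (G : SimpleGraph V)

open Classical in
theorem generator_mulVec (f : Equiv.Perm V → ℝ) (σ : Equiv.Perm V) :
    (generator G).mulVec f σ =
      ∑ e : Sym2 V with e ∈ G.edgeSet, (f (transposition e * σ) - f σ) := by
  simp only [Matrix.mulVec, dotProduct, generator, Matrix.of_apply, Finset.sum_mul]
  rw [Finset.sum_comm]
  refine Finset.sum_congr rfl fun e _ => ?_
  simp [sub_mul, Finset.sum_sub_distrib]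

omit [DecidableEq V] in
open Classical in
theorem card_filter_edgeSet :
    (Finset.univ.filter fun e : Sym2 V => e ∈ G.edgeSet).card = G.edgeSet.ncard := by
  rw [← Set.ncard_coe_finset]
  congr 1
  ext e
  simp

/-- Up to a multiple of the identity, `t Q` is the entrywise nonnegative matrix `t B`; the identity
part commutes and contributes only a positive scalar factor to the exponential. -/
theorem transition_apply_nonneg {t : ℝ} (ht : 0 ≤ t) (σ σ' : Equiv.Perm V) :
    0 ≤ transition G t σ σ' := by
  classical
  let B : Matrix (Equiv.Perm V) (Equiv.Perm V) ℝ := Matrix.of fun σ σ' =>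
    ∑ e : Sym2 V with e ∈ G.edgeSet, (if σ' = transposition e * σ then (1 : ℝ) else 0)
  have hB : t • generator G = t • B + (-(t * G.edgeSet.ncard)) • 1 := by
    ext σ σ'
    simp only [generator, B, Matrix.smul_apply, Matrix.add_apply, Matrix.of_apply, smul_eq_mul,
      Finset.sum_sub_distrib, Finset.sum_const, card_filter_edgeSet, Matrix.one_apply,
      eq_comm (a := σ'), nsmul_eq_mul]
    ring
  have hexp : NormedSpace.exp ((-(t * G.edgeSet.ncard)) •
      (1 : Matrix (Equiv.Perm V) (Equiv.Perm V) ℝ)) =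
      Real.exp (-(t * G.edgeSet.ncard)) • 1 := by
    rw [Real.exp_eq_exp_ℝ, ← Algebra.algebraMap_eq_smul_one, ← Algebra.algebraMap_eq_smul_one]
    exact (NormedSpace.algebraMap_exp_comm (𝔸 := Matrix (Equiv.Perm V) (Equiv.Perm V) ℝ)
      (-(t * G.edgeSet.ncard))).symm
  rw [transition, hB, Matrix.exp_add_of_commute _ _ ((Commute.one_right _).smul_right _), hexp]
  simp only [mul_smul_comm, mul_one, Matrix.smul_apply, smul_eq_mul]
  refine mul_nonneg (Real.exp_pos _).le (exp_apply_nonneg (fun i j => ?_) _ _)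
  refine mul_nonneg ht (Finset.sum_nonneg fun e _ => ?_)
  split_ifs <;> norm_num

theorem expect_eq_mulVec (t : ℝ) (f : Equiv.Perm V → ℝ) :
    expect G t f = (transition G t).mulVec f 1 := rfl

/-- Kolmogorov's equation: `exp (t Q)` has derivative `exp (t Q) Q`. -/
theorem hasDerivAt_expect (f : Equiv.Perm V → ℝ) (t : ℝ) :
    HasDerivAt (fun t => expect G t f) (expect G t ((generator G).mulVec f)) t := by
  have h := hasDerivAt_exp_smul_const (𝕂 := ℝ) (generator G) t
  have h1 : ∀ σ σ', HasDerivAt (fun t => transition G t σ σ')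
      ((transition G t * generator G) σ σ') t := by
    intro σ σ'
    exact (Matrix.entryLinearMap ℝ ℝ σ σ').toContinuousLinearMap.hasFDerivAt.comp_hasDerivAt t h
  have h2 : expect G t ((generator G).mulVec f) =
      ∑ σ, (transition G t * generator G) 1 σ * f σ := by
    rw [expect_eq_mulVec, Matrix.mulVec_mulVec]
    rfl
  rw [h2]
  exact HasDerivAt.fun_sum fun σ _ => (h1 1 σ).mul_const (f σ)

theorem continuous_expect (f : Equiv.Perm V → ℝ) : Continuous fun t => expect G t f :=
  continuous_iff_continuousAt.mpr fun t => (hasDerivAt_expect G f t).continuousAt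

theorem expect_add (t : ℝ) (f g : Equiv.Perm V → ℝ) :
    expect G t (fun σ => f σ + g σ) = expect G t f + expect G t g := by
  simp [expect, mul_add, Finset.sum_add_distrib]

theorem expect_const_mul (t c : ℝ) (f : Equiv.Perm V → ℝ) :
    expect G t (fun σ => c * f σ) = c * expect G t f := by
  simp only [expect, Finset.mul_sum]
  exact Finset.sum_congr rfl fun _ _ => by ring

theorem expect_mono {t : ℝ} (ht : 0 ≤ t) {f g : Equiv.Perm V → ℝ} (h : ∀ σ, f σ ≤ g σ) :
    expect G t f ≤ expect G t g :=
  Finset.sum_le_sum fun σ _ => mul_le_mul_of_nonneg_left (h σ) (transition_apply_nonneg G ht 1 σ)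

/-- Conservation of mass: the generator kills constants, so the expectation keeps its value at time
`0`. -/
theorem expect_const (t c : ℝ) : expect G t (fun _ => c) = c := by
  have h : ∀ s, HasDerivAt (fun t => expect G t fun _ => c) 0 s := by
    intro s
    have := hasDerivAt_expect G (fun _ => c) s
    have h0 : (generator G).mulVec (fun _ => c) = fun _ => 0 := by
      ext σ
      rw [generator_mulVec]
      simp
    rw [h0] at this
    simpa [expect] using this
  have h1 := is_const_of_deriv_eq_zero (fun s => (h s).differentiableAt)
    (fun s => (h s).deriv) t 0
  rw [h1]
  simp [expect_eq_mulVec, transition]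


/-! ### Evolution of the partition function -/

omit [DecidableEq V] in
open Classical in
theorem sum_edgeSet_ite (σ : Equiv.Perm V) (p q : ℝ) :
    ∑ e : Sym2 V with e ∈ G.edgeSet, (if JoinsCycle σ e then p else q) =
      cycleEdges G σ * p + (G.edgeSet.ncard - cycleEdges G σ) * q := by
  have h1 : ((Finset.univ.filter fun e : Sym2 V => e ∈ G.edgeSet).filter
      fun e => JoinsCycle σ e).card = cycleEdges G σ := by
    rw [cycleEdges, ← Set.ncard_coe_finset]
    congr 1
    ext e
    simp
  have h2 := Finset.card_filter_add_card_filter_not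
    (s := Finset.univ.filter fun e : Sym2 V => e ∈ G.edgeSet) (fun e => JoinsCycle σ e)
  rw [h1, card_filter_edgeSet] at h2
  rw [Finset.sum_ite, Finset.sum_const, Finset.sum_const, h1, ← h2]
  push_cast
  simp [nsmul_eq_mul]

/-- An edge inside a cycle multiplies the weight by `θ`, any other edge by `θ⁻¹`. -/
theorem generator_mulVec_pow {θ : ℝ} (hθ : θ ≠ 0) (σ : Equiv.Perm V) :
    (generator G).mulVec (fun σ => θ ^ numCycles σ) σ =
      (θ - θ⁻¹) * (θ ^ numCycles σ * cycleEdges G σ) +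
        (θ⁻¹ - 1) * G.edgeSet.ncard * θ ^ numCycles σ := by
  classical
  rw [generator_mulVec]
  have h : ∀ e ∈ Finset.univ.filter (fun e : Sym2 V => e ∈ G.edgeSet),
      θ ^ numCycles (transposition e * σ) - θ ^ numCycles σ =
        if JoinsCycle σ e then (θ - 1) * θ ^ numCycles σ else (θ⁻¹ - 1) * θ ^ numCycles σ := by
    intro e he
    rw [Finset.mem_filter] at he
    split_ifs with hj
    · rw [numCycles_transposition_mul_of_joinsCycle he.2 hj]
      ring
    · rw [← numCycles_transposition_mul_of_not_joinsCycle hj]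
      field_simp
      ring
  rw [Finset.sum_congr rfl h, sum_edgeSet_ite]
  ring

/-- Substitute for the identity for `θ ^ N`, which is void at `θ = 1`. -/
theorem generator_mulVec_numCycles (σ : Equiv.Perm V) :
    (generator G).mulVec (fun σ => (numCycles σ : ℝ)) σ =
      2 * cycleEdges G σ + -G.edgeSet.ncard := by
  classical
  rw [generator_mulVec]
  have h : ∀ e ∈ Finset.univ.filter (fun e : Sym2 V => e ∈ G.edgeSet),
      (numCycles (transposition e * σ) : ℝ) - numCycles σ =
        if JoinsCycle σ e then 1 else -1 := by
    intro e he
    rw [Finset.mem_filter] at he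
    split_ifs with hj
    · rw [numCycles_transposition_mul_of_joinsCycle he.2 hj]
      push_cast
      ring
    · rw [← numCycles_transposition_mul_of_not_joinsCycle hj]
      push_cast
      ring
  rw [Finset.sum_congr rfl h, sum_edgeSet_ite]
  ring

theorem partitionFunction_pos {θ t : ℝ} (hθ : 0 < θ) (ht : 0 ≤ t) :
    0 < partitionFunction G θ t := by
  obtain ⟨σ₀, -, h⟩ := Finset.exists_min_image Finset.univ
    (fun σ : Equiv.Perm V => θ ^ numCycles σ) ⟨1, Finset.mem_univ _⟩
  calc 0 < θ ^ numCycles σ₀ := pow_pos hθ _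
    _ = expect G t fun _ => θ ^ numCycles σ₀ := (expect_const G t _).symm
    _ ≤ _ := expect_mono G ht fun σ => h σ (Finset.mem_univ _)

/-- The weighted expectation of the number of edges spanned by the cycles. -/
def meanCycleEdges (θ t : ℝ) : ℝ :=
  expect G t (fun σ => θ ^ numCycles σ * cycleEdges G σ) / partitionFunction G θ t

theorem continuous_partitionFunction (θ : ℝ) : Continuous (partitionFunction G θ) :=
  continuous_expect G _

theorem continuousOn_meanCycleEdges {θ : ℝ} (hθ : 0 < θ) :
    ContinuousOn (meanCycleEdges G θ) (Set.Ici 0) :=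
  (continuous_expect G _).continuousOn.div (continuous_partitionFunction G θ).continuousOn
    fun _ ht => (partitionFunction_pos G hθ ht).ne'

theorem continuousOn_prob {θ : ℝ} (hθ : 0 < θ) (A : Equiv.Perm V → Prop) :
    ContinuousOn (fun t => prob G θ t A) (Set.Ici 0) :=
  (continuous_expect G _).continuousOn.div (continuous_partitionFunction G θ).continuousOn
    fun _ ht => (partitionFunction_pos G hθ ht).ne'

omit [Fintype V] [DecidableEq V] in
theorem intervalIntegrable_of_continuousOn_Ici {f : ℝ → ℝ} (hf : ContinuousOn f (Set.Ici 0))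
    {a b : ℝ} (ha : 0 ≤ a) (hab : a ≤ b) : IntervalIntegrable f MeasureTheory.volume a b := by
  refine (hf.mono ?_).intervalIntegrable
  rw [Set.uIcc_of_le hab]
  exact fun x hx => ha.trans hx.1

theorem integral_meanCycleEdges_log {θ : ℝ} (hθ : 0 < θ) {a b : ℝ} (ha : 0 ≤ a) (hab : a ≤ b) :
    Real.log (partitionFunction G θ b) - Real.log (partitionFunction G θ a) =
      (θ - θ⁻¹) * (∫ t in a..b, meanCycleEdges G θ t) +
        (θ⁻¹ - 1) * G.edgeSet.ncard * (b - a) := by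
  have hint : IntervalIntegrable (meanCycleEdges G θ) MeasureTheory.volume a b :=
    intervalIntegrable_of_continuousOn_Ici (continuousOn_meanCycleEdges G hθ) ha hab
  have h := intervalIntegral.integral_eq_sub_of_hasDerivAt (a := a) (b := b)
    (f := fun t => Real.log (partitionFunction G θ t))
    (f' := fun t => (θ - θ⁻¹) * meanCycleEdges G θ t + (θ⁻¹ - 1) * G.edgeSet.ncard) (by
      intro t ht
      rw [Set.uIcc_of_le hab] at ht
      have hZ := partitionFunction_pos G hθ (ha.trans ht.1)
      have hd := (hasDerivAt_expect G (fun σ => θ ^ numCycles σ) t).log hZ.ne'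
      convert! hd using 1
      rw [show (generator G).mulVec (fun σ => θ ^ numCycles σ) = _ from
        funext fun σ => generator_mulVec_pow G hθ.ne' σ, expect_add, expect_const_mul,
        expect_const_mul]
      change _ = (_ + _ * partitionFunction G θ t) / partitionFunction G θ t
      rw [meanCycleEdges]
      field_simp)
    ((hint.const_mul _).add intervalIntegrable_const)
  rw [← h, intervalIntegral.integral_add (hint.const_mul _) intervalIntegrable_const,
    intervalIntegral.integral_const_mul, intervalIntegral.integral_const]
  simp only [smul_eq_mul]
  ring

theorem integral_meanCycleEdges_one {a b : ℝ} (ha : 0 ≤ a) (hab : a ≤ b) :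
    expect G b (fun σ => (numCycles σ : ℝ)) - expect G a (fun σ => (numCycles σ : ℝ)) =
      2 * (∫ t in a..b, meanCycleEdges G 1 t) - G.edgeSet.ncard * (b - a) := by
  have hint : IntervalIntegrable (meanCycleEdges G 1) MeasureTheory.volume a b :=
    intervalIntegrable_of_continuousOn_Ici (continuousOn_meanCycleEdges G one_pos) ha hab
  have h := intervalIntegral.integral_eq_sub_of_hasDerivAt (a := a) (b := b)
    (f := fun t => expect G t (fun σ => (numCycles σ : ℝ)))
    (f' := fun t => 2 * meanCycleEdges G 1 t + -G.edgeSet.ncard) (by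
      intro t _
      convert! hasDerivAt_expect G (fun σ => (numCycles σ : ℝ)) t using 1
      rw [show (generator G).mulVec (fun σ => (numCycles σ : ℝ)) = _ from
        funext fun σ => generator_mulVec_numCycles G σ, expect_add, expect_const_mul,
        expect_const]
      simp [meanCycleEdges, partitionFunction, expect_const])
    ((hint.const_mul _).add intervalIntegrable_const)
  rw [← h, intervalIntegral.integral_add (hint.const_mul _) intervalIntegrable_const,
    intervalIntegral.integral_const_mul, intervalIntegral.integral_const]
  simp only [smul_eq_mul]
  ring

/-- The cost per vertex of moving `log Z_θ` (for `θ = 1`, the mean number of cycles) across its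
whole range. -/
def entropyCost (θ : ℝ) : ℝ :=
  if θ = 1 then 1 else θ * Real.log θ / (θ - 1)

/-- The integrated equation solves for the integral because `θ (θ - θ⁻¹) = (θ - 1) (θ + 1)`. What
remains is the increment of `log Z_θ`, controlled by `1 ≤ N ≤ |V|` weakened to `0 ≤ N ≤ |V|`. -/
theorem le_integral_meanCycleEdges {θ : ℝ} (hθ : 0 < θ) {a b : ℝ} (ha : 0 ≤ a) (hab : a ≤ b) :
    G.edgeSet.ncard * (b - a) - Fintype.card V * entropyCost θ ≤
      (1 + θ) * ∫ t in a..b, meanCycleEdges G θ t := by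
  have hb := ha.trans hab
  have hN : ∀ σ : Equiv.Perm V, (numCycles σ : ℝ) ≤ Fintype.card V := fun σ => by
    exact_mod_cast numCycles_le_card σ
  rcases eq_or_ne θ 1 with rfl | h1
  · have h := integral_meanCycleEdges_one G ha hab
    have hge : 0 ≤ expect G b (fun σ => (numCycles σ : ℝ)) := by
      rw [← expect_const G b 0]
      exact expect_mono G hb fun σ => Nat.cast_nonneg _
    have hle : expect G a (fun σ => (numCycles σ : ℝ)) ≤ Fintype.card V := by
      rw [← expect_const G a (Fintype.card V : ℝ)]
      exact expect_mono G ha hN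
    rw [entropyCost, if_pos rfl]
    linarith
  have h := integral_meanCycleEdges_log G hθ ha hab
  have hZa := partitionFunction_pos G hθ ha
  have hZb := partitionFunction_pos G hθ hb
  rw [entropyCost, if_neg h1]
  set I := ∫ t in a..b, meanCycleEdges G θ t
  set L := Real.log (partitionFunction G θ b) - Real.log (partitionFunction G θ a) with hL
  have hkey : (1 + θ) * I = G.edgeSet.ncard * (b - a) + θ * L / (θ - 1) := by
    have : θ - 1 ≠ 0 := sub_ne_zero.mpr h1
    rw [h]
    field_simp
    ring
  -- Both logarithms lie between `0` and `|V| log θ`, whose order depends on the sign of `θ - 1`;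
  -- dividing by `θ - 1` makes the two cases agree.
  have hbound : -(Fintype.card V * (Real.log θ / (θ - 1))) ≤ L / (θ - 1) := by
    rw [← mul_div_assoc, ← neg_div]
    rcases lt_or_gt_of_ne h1 with hlt | hgt
    · refine div_le_div_of_nonpos_of_le (by linarith) ?_
      have h2 : Real.log (partitionFunction G θ b) ≤ 0 := by
        refine Real.log_nonpos hZb.le ?_
        rw [← expect_const G b 1]
        exact expect_mono G hb fun σ => pow_le_one₀ hθ.le hlt.le
      have h3 : Fintype.card V * Real.log θ ≤ Real.log (partitionFunction G θ a) := by
        rw [← Real.log_pow]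
        refine Real.log_le_log (pow_pos hθ _) ?_
        rw [← expect_const G a (θ ^ Fintype.card V)]
        exact expect_mono G ha fun σ => pow_le_pow_of_le_one hθ.le hlt.le (numCycles_le_card σ)
      linarith
    · refine div_le_div_of_nonneg_right ?_ (by linarith)
      have h2 : 0 ≤ Real.log (partitionFunction G θ b) := by
        refine Real.log_nonneg ?_
        rw [← expect_const G b 1]
        exact expect_mono G hb fun σ => one_le_pow₀ hgt.le
      have h3 : Real.log (partitionFunction G θ a) ≤ Fintype.card V * Real.log θ := by
        rw [← Real.log_pow]
        refine Real.log_le_log hZa ?_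
        rw [← expect_const G a (θ ^ Fintype.card V)]
        exact expect_mono G ha fun σ => pow_le_pow_right₀ hgt.le (numCycles_le_card σ)
      linarith
  have := mul_le_mul_of_nonneg_left hbound hθ.le
  rw [hkey]
  calc _ = G.edgeSet.ncard * (b - a) + θ * -(Fintype.card V * (Real.log θ / (θ - 1))) := by ring
    _ ≤ G.edgeSet.ncard * (b - a) + θ * (L / (θ - 1)) := by linarith
    _ = _ := by ring

/-- Use the trivial bound `|E|` when a macroscopic cycle exists, and sparsity otherwise. -/
theorem meanCycleEdges_le {θ η ε : ℝ} (hθ : 0 < θ) (hG : SmallSetsSparse G η ε) {t : ℝ}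
    (ht : 0 ≤ t) :
    meanCycleEdges G θ t ≤ (1 + ε) * Fintype.card V +
      (G.edgeSet.ncard - (1 + ε) * Fintype.card V) * prob G θ t (HasMacroscopicCycle η) := by
  classical
  have hZ := partitionFunction_pos G hθ ht
  have h : expect G t (fun σ => θ ^ numCycles σ * cycleEdges G σ) ≤
      (1 + ε) * Fintype.card V * partitionFunction G θ t +
      (G.edgeSet.ncard - (1 + ε) * Fintype.card V) *
        expect G t (fun σ => θ ^ numCycles σ * (if HasMacroscopicCycle η σ then 1 else 0)) := by
    rw [partitionFunction, ← expect_const_mul, ← expect_const_mul, ← expect_add]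
    refine expect_mono G ht fun σ => ?_
    have hp : 0 ≤ θ ^ numCycles σ := (pow_pos hθ _).le
    by_cases hA : HasMacroscopicCycle η σ
    · have : (cycleEdges G σ : ℝ) ≤ G.edgeSet.ncard := by
        exact_mod_cast cycleEdges_le_ncard_edgeSet G σ
      have := mul_le_mul_of_nonneg_left this hp
      rw [if_pos hA]
      linarith
    · have := mul_le_mul_of_nonneg_left (cycleEdges_le_of_smallSetsSparse hG hA) hp
      rw [if_neg hA]
      linarith
  rw [meanCycleEdges, div_le_iff₀ hZ]
  have hprob : expect G t (fun σ => θ ^ numCycles σ * (if HasMacroscopicCycle η σ then 1 else 0)) =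
      prob G θ t (HasMacroscopicCycle η) * partitionFunction G θ t := by
    rw [prob, div_mul_cancel₀ _ hZ.ne']
  rw [hprob] at h
  linarith

theorem le_integral_prob {θ η ε : ℝ} (hθ : 0 < θ) (hG : SmallSetsSparse G η ε) {a b : ℝ}
    (ha : 0 ≤ a) (hab : a ≤ b) :
    G.edgeSet.ncard * (b - a) - Fintype.card V * entropyCost θ
        - (1 + θ) * ((1 + ε) * Fintype.card V * (b - a)) ≤
      (1 + θ) * (G.edgeSet.ncard - (1 + ε) * Fintype.card V) *
        ∫ t in a..b, prob G θ t (HasMacroscopicCycle η) := by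
  have hint : IntervalIntegrable (fun t => prob G θ t (HasMacroscopicCycle η))
      MeasureTheory.volume a b :=
    intervalIntegrable_of_continuousOn_Ici (continuousOn_prob G hθ _) ha hab
  have h1 := le_integral_meanCycleEdges G hθ ha hab
  have h2 : ∫ t in a..b, meanCycleEdges G θ t ≤ ∫ t in a..b, ((1 + ε) * Fintype.card V +
      (G.edgeSet.ncard - (1 + ε) * Fintype.card V) * prob G θ t (HasMacroscopicCycle η)) :=
    intervalIntegral.integral_mono_on hab
      (intervalIntegrable_of_continuousOn_Ici (continuousOn_meanCycleEdges G hθ) ha hab)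
      (intervalIntegrable_const.add (hint.const_mul _))
      fun t ht => meanCycleEdges_le G hθ hG (ha.trans ht.1)
  rw [intervalIntegral.integral_add intervalIntegrable_const (hint.const_mul _),
    intervalIntegral.integral_const, intervalIntegral.integral_const_mul, smul_eq_mul] at h2
  have h3 := mul_le_mul_of_nonneg_left h2 (show 0 ≤ 1 + θ by linarith)
  linear_combination h1 + h3

end Semigroup

/-! ### Switchings of regular graphs -/

/-- The switching of `G` that replaces the edges `xy`, `uv` by `xu`, `yv`. -/
def switch {V : Type*} (G : SimpleGraph V) (x y u v : V) : SimpleGraph V :=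
  SimpleGraph.fromEdgeSet ((G.edgeSet \ {s(x, y), s(u, v)}) ∪ {s(x, u), s(y, v)})

/-- The switching at `x, y, u, v` produces a simple graph with the same degrees. -/
structure Switchable {V : Type*} (G : SimpleGraph V) (x y u v : V) : Prop where
  adj_xy : G.Adj x y
  adj_uv : G.Adj u v
  ux : u ≠ x
  uy : u ≠ y
  vx : v ≠ x
  vy : v ≠ y
  not_adj_xu : ¬ G.Adj x u
  not_adj_yv : ¬ G.Adj y v

theorem switch_adj {V : Type*} {G : SimpleGraph V} {x y u v : V} (h : Switchable G x y u v)
    {a b : V} : (switch G x y u v).Adj a b ↔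
      (G.Adj a b ∧ s(a, b) ≠ s(x, y) ∧ s(a, b) ≠ s(u, v)) ∨ s(a, b) = s(x, u) ∨
        s(a, b) = s(y, v) := by
  have h1 := h.ux
  have h2 := h.vy
  simp only [switch, SimpleGraph.fromEdgeSet_adj, Set.mem_union, Set.mem_sdiff,
    SimpleGraph.mem_edgeSet, Set.mem_insert_iff, Set.mem_singleton_iff, not_or]
  refine ⟨fun h => h.1, fun h => ⟨h, ?_⟩⟩
  rcases h with h | h | h
  · exact G.ne_of_adj h.1
  · rintro rfl
    simp only [Sym2.eq_iff] at h
    grind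
  · rintro rfl
    simp only [Sym2.eq_iff] at h
    grind

/-- With `y` and `u` exchanged, the same four vertices switch back; this makes switching injective.
-/
theorem Switchable.switch {V : Type*} {G : SimpleGraph V} {x y u v : V}
    (h : Switchable G x y u v) : Switchable (switch G x y u v) x u y v := by
  have hxy := G.ne_of_adj h.adj_xy
  have huv := G.ne_of_adj h.adj_uv
  obtain ⟨h1, h2, h3, h4, h5, h6, h7, h8⟩ := id h
  refine ⟨?_, ?_, hxy.symm, h4.symm, h5, huv.symm, ?_, ?_⟩ <;> rw [switch_adj h] <;>
    simp only [Sym2.eq_iff] <;> grind [G.adj_comm]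

theorem switch_switch {V : Type*} {G : SimpleGraph V} {x y u v : V}
    (h : Switchable G x y u v) :
    Interchange.switch (Interchange.switch G x y u v) x u y v = G := by
  ext a b
  rw [switch_adj h.switch, switch_adj h]
  obtain ⟨h1, h2, h3, h4, h5, h6, h7, h8⟩ := h
  have e1 : s(a, b) = s(x, y) → G.Adj a b := fun e => by
    rwa [← SimpleGraph.mem_edgeSet, e]
  have e2 : s(a, b) = s(u, v) → G.Adj a b := fun e => by
    rwa [← SimpleGraph.mem_edgeSet, e]
  have e3 : s(a, b) = s(x, u) → ¬ G.Adj a b := fun e => by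
    rwa [← SimpleGraph.mem_edgeSet, e]
  have e4 : s(a, b) = s(y, v) → ¬ G.Adj a b := fun e => by
    rwa [← SimpleGraph.mem_edgeSet, e]
  tauto

theorem isRegularOfDegree_of_perm {V : Type*} {G G' : SimpleGraph V} [G.LocallyFinite]
    [G'.LocallyFinite] {d : ℕ} (hG : G.IsRegularOfDegree d)
    (h : ∀ a, ∃ π : Equiv.Perm V, ∀ b, G'.Adj a b ↔ G.Adj a (π b)) :
    G'.IsRegularOfDegree d := by
  intro a
  obtain ⟨π, hπ⟩ := h a
  rw [← hG a, ← SimpleGraph.card_neighborSet_eq_degree, ← SimpleGraph.card_neighborSet_eq_degree]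
  exact Fintype.card_congr (π.subtypeEquiv fun b => hπ b)

/-- Each of the four vertices trades one neighbour for another, which a transposition of the
vertices records; other neighbourhoods are unchanged. -/
theorem isRegularOfDegree_switch {V : Type*} {G : SimpleGraph V} {x y u v : V}
    [G.LocallyFinite] [(switch G x y u v).LocallyFinite]
    (h : Switchable G x y u v) {d : ℕ} (hG : G.IsRegularOfDegree d) :
    (switch G x y u v).IsRegularOfDegree d := by
  classical
  refine isRegularOfDegree_of_perm hG fun a => ?_
  have hxy := G.ne_of_adj h.adj_xy
  have huv := G.ne_of_adj h.adj_uv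
  simp only [switch_adj h]
  obtain ⟨h1, h2, h3, h4, h5, h6, h7, h8⟩ := h
  by_cases hax : a = x
  · refine ⟨Equiv.swap y u, fun b => ?_⟩
    simp only [Equiv.swap_apply_def, Sym2.eq_iff]
    grind [G.adj_comm]
  by_cases hay : a = y
  · refine ⟨Equiv.swap x v, fun b => ?_⟩
    simp only [Equiv.swap_apply_def, Sym2.eq_iff]
    grind [G.adj_comm]
  by_cases hau : a = u
  · refine ⟨Equiv.swap v x, fun b => ?_⟩
    simp only [Equiv.swap_apply_def, Sym2.eq_iff]
    grind [G.adj_comm]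
  by_cases hav : a = v
  · refine ⟨Equiv.swap u y, fun b => ?_⟩
    simp only [Equiv.swap_apply_def, Sym2.eq_iff]
    grind [G.adj_comm]
  · refine ⟨1, fun b => ?_⟩
    simp only [Equiv.Perm.one_apply, Sym2.eq_iff]
    grind

/-! ### Regular graphs containing prescribed edges -/

open Classical in
/-- The `d`-regular graphs on `Fin n` that contain all the edges in `H`. -/
def regularGraphsContaining (d n : ℕ) (H : Finset (Sym2 (Fin n))) :
    Finset (SimpleGraph (Fin n)) :=
  (regularGraphs d n).filter fun G => ∀ e ∈ H, e ∈ G.edgeSet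

open Classical in
theorem card_neighbors {d n : ℕ} {G : SimpleGraph (Fin n)} (hG : G ∈ regularGraphs d n)
    (x : Fin n) : (Finset.univ.filter fun u => G.Adj x u).card = d := by
  have h : G.IsRegularOfDegree d := by simpa [regularGraphs] using hG
  rw [← h x, ← SimpleGraph.card_neighborFinset_eq_degree]
  congr 1
  ext u
  simp

open Classical in
theorem card_pairs_mem_le {V : Type*} [Fintype V] (H : Finset (Sym2 V)) :
    (Finset.univ.filter fun p : V × V => s(p.1, p.2) ∈ H).card ≤ 2 * H.card := by
  refine (Finset.card_le_mul_card_image (f := fun p : V × V => s(p.1, p.2)) _ 2 ?_).trans ?_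
  · intro e _
    induction e using Sym2.inductionOn with
    | hf x y =>
    refine (Finset.card_le_card (t := {(x, y), (y, x)}) ?_).trans Finset.card_le_two
    rintro ⟨u, v⟩ hp
    simp only [Finset.mem_filter, Sym2.eq_iff] at hp
    simp only [Finset.mem_insert, Finset.mem_singleton, Prod.mk.injEq]
    exact hp.2
  · refine Nat.mul_le_mul_left _ (Finset.card_le_card ?_)
    intro e he
    simp only [Finset.mem_image, Finset.mem_filter] at he
    obtain ⟨p, hp, rfl⟩ := he
    exact hp.2

open Classical in
theorem card_pairs_adj {d n : ℕ} {G : SimpleGraph (Fin n)} (hG : G ∈ regularGraphs d n)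
    (S : Finset (Fin n)) :
    (Finset.univ.filter fun p : Fin n × Fin n => p.1 ∈ S ∧ G.Adj p.1 p.2).card = S.card * d := by
  have h : (Finset.univ.filter fun p : Fin n × Fin n => p.1 ∈ S ∧ G.Adj p.1 p.2) =
      S.biUnion fun u => (Finset.univ.filter fun v => G.Adj u v).image (Prod.mk u) := by
    ext ⟨u, v⟩
    simp only [Finset.mem_filter, Finset.mem_univ, true_and, Finset.mem_biUnion,
      Finset.mem_image, Prod.mk.injEq]
    exact ⟨fun h => ⟨u, h.1, v, h.2, rfl, rfl⟩, by rintro ⟨_, h, _, h', rfl, rfl⟩; exact ⟨h, h'⟩⟩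
  rw [h, Finset.card_biUnion]
  · simp [Finset.card_image_of_injective _ (Prod.mk_right_injective _), card_neighbors hG]
  · intro a _ b _ hab
    rw [Function.onFun, Finset.disjoint_left]
    rintro ⟨u, v⟩ h1 h2
    simp only [Finset.mem_image, Prod.mk.injEq] at h1 h2
    obtain ⟨_, -, rfl, -⟩ := h1
    obtain ⟨_, -, rfl, -⟩ := h2
    exact hab rfl

open Classical in
-- Among the `n * d` oriented edges `(u, v)`, failures have their edge in `H`, or `u` equal to `x`
-- or `y` or adjacent to `x`, or `v` equal to `x` or `y` or adjacent to `y`.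
theorem card_switchable {d n : ℕ} {G : SimpleGraph (Fin n)} (hG : G ∈ regularGraphs d n)
    {x y : Fin n} (hxy : G.Adj x y) (H : Finset (Sym2 (Fin n))) :
    n * d ≤ (Finset.univ.filter fun p : Fin n × Fin n =>
      Switchable G x y p.1 p.2 ∧ s(p.1, p.2) ∉ H).card + 2 * H.card + 2 * ((d + 2) * d) := by
  set A := Finset.univ.filter fun p : Fin n × Fin n =>
      Switchable G x y p.1 p.2 ∧ s(p.1, p.2) ∉ H
  set B := Finset.univ.filter fun p : Fin n × Fin n => s(p.1, p.2) ∈ H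
  let S : Fin n → Finset (Fin n) := fun w => {x, y} ∪ Finset.univ.filter fun u => G.Adj w u
  have hS : ∀ w, (S w).card ≤ d + 2 := fun w => by
    refine (Finset.card_union_le _ _).trans ?_
    rw [card_neighbors hG, add_comm]
    exact Nat.add_le_add_left Finset.card_le_two _
  let C : Finset (Fin n) → Finset (Fin n × Fin n) := fun S =>
    Finset.univ.filter fun p : Fin n × Fin n => p.1 ∈ S ∧ G.Adj p.1 p.2
  have hC : ∀ w, (C (S w)).card ≤ (d + 2) * d := fun w => by
    rw [card_pairs_adj hG]
    exact Nat.mul_le_mul_right _ (hS w)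
  have hall : (C Finset.univ).card = n * d := by
    rw [card_pairs_adj hG, Finset.card_univ, Fintype.card_fin]
  have hsub : C Finset.univ ⊆ ((A ∪ B) ∪ C (S x)) ∪ (C (S y)).image Prod.swap := by
    rintro ⟨u, v⟩ hp
    simp only [C, Finset.mem_filter, Finset.mem_univ, true_and] at hp
    simp only [A, B, C, S, Finset.mem_union, Finset.mem_filter, Finset.mem_univ, true_and,
      Finset.mem_image, Prod.exists, Prod.swap_prod_mk, Prod.mk.injEq, Finset.mem_insert,
      Finset.mem_singleton]
    by_contra hcon
    push Not at hcon
    obtain ⟨⟨⟨hA, hB⟩, hx⟩, hy⟩ := hcon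
    have hx' : ¬ ((u = x ∨ u = y) ∨ G.Adj x u) := fun h => hx h hp
    have hy' : ¬ ((v = x ∨ v = y) ∨ G.Adj y v) := fun h => hy v u ⟨h, hp.symm⟩ rfl rfl
    push Not at hx' hy'
    exact hB (hA ⟨hxy, hp, hx'.1.1, hx'.1.2, hy'.1.1, hy'.1.2, hx'.2, hy'.2⟩)
  have h1 := Finset.card_le_card hsub
  rw [hall] at h1
  have h2 := Finset.card_union_le ((A ∪ B) ∪ C (S x)) ((C (S y)).image Prod.swap)
  have h3 := Finset.card_union_le (A ∪ B) (C (S x))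
  have h4 := Finset.card_union_le A B
  have h5 := Finset.card_image_le (s := C (S y)) (f := Prod.swap)
  have h6 : B.card ≤ 2 * H.card := by convert! card_pairs_mem_le H
  have := hC x
  have := hC y
  omega

/-- Switching `e` away while sparing `H` maps pairs (graph, switching) injectively to pairs (graph
containing `H`, neighbours `u` of `x` and `v` of `y`), with `d * d` choices of neighbours per graph.
The truncated subtraction makes the bound void for small `n`. -/
theorem card_regularGraphsContaining_insert {d n : ℕ} {H : Finset (Sym2 (Fin n))}
    {e : Sym2 (Fin n)} (he : e ∉ H) :
    (regularGraphsContaining d n (insert e H)).card *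
      (n * d - (2 * H.card + 2 * ((d + 2) * d))) ≤
        (regularGraphsContaining d n H).card * (d * d) := by
  classical
  induction e using Sym2.inductionOn with
  | hf x y =>
  let P : SimpleGraph (Fin n) → Finset (Fin n × Fin n) := fun G =>
    Finset.univ.filter fun p => Switchable G x y p.1 p.2 ∧ s(p.1, p.2) ∉ H
  let N : SimpleGraph (Fin n) → Finset (Fin n × Fin n) := fun G =>
    (Finset.univ.filter fun u => G.Adj x u) ×ˢ (Finset.univ.filter fun v => G.Adj y v)
  have h1 : (regularGraphsContaining d n (insert s(x, y) H)).card *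
      (n * d - (2 * H.card + 2 * ((d + 2) * d))) ≤
      ((regularGraphsContaining d n (insert s(x, y) H)).sigma P).card := by
    rw [Finset.card_sigma, ← smul_eq_mul]
    refine Finset.card_nsmul_le_sum _ _ _ fun G hG => ?_
    simp only [regularGraphsContaining, Finset.mem_filter] at hG
    have := card_switchable (x := x) (y := y) hG.1 (hG.2 _ (Finset.mem_insert_self _ _)) H
    change _ ≤ (Finset.univ.filter fun p : Fin n × Fin n =>
      Switchable G x y p.1 p.2 ∧ s(p.1, p.2) ∉ H).card
    omega
  have h2 : ((regularGraphsContaining d n H).sigma N).card =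
      (regularGraphsContaining d n H).card * (d * d) := by
    rw [Finset.card_sigma, ← smul_eq_mul]
    refine Finset.sum_const_nat (fun G hG => ?_) |>.trans (smul_eq_mul _ _).symm
    simp only [regularGraphsContaining, Finset.mem_filter] at hG
    rw [Finset.card_product, card_neighbors hG.1, card_neighbors hG.1]
  rw [← h2]
  refine h1.trans (Finset.card_le_card_of_injOn
    (fun q => ⟨switch q.1 x y q.2.1 q.2.2, q.2⟩) ?_ ?_)
  · rintro ⟨G, u, v⟩ hq
    simp only [P, regularGraphsContaining, Finset.coe_sigma, Set.mem_sigma_iff, Finset.mem_coe,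
      Finset.mem_filter, Finset.mem_univ, true_and] at hq
    obtain ⟨⟨hR, hH⟩, hs, huv⟩ := hq
    simp only [N, regularGraphsContaining, Finset.coe_sigma, Set.mem_sigma_iff, Finset.mem_coe,
      Finset.mem_filter, Finset.mem_univ, true_and, Finset.mem_product]
    refine ⟨⟨?_, fun f hf => ?_⟩, hs.switch.adj_xy, hs.switch.adj_uv⟩
    · simp only [regularGraphs, Finset.mem_filter, Finset.mem_univ, true_and] at hR ⊢
      exact isRegularOfDegree_switch hs hR
    · have hfG := hH f (Finset.mem_insert_of_mem hf)
      have hf1 : f ≠ s(x, y) := fun h => he (h ▸ hf)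
      have hf2 : f ≠ s(u, v) := fun h => huv (h ▸ hf)
      induction f using Sym2.inductionOn with
      | hf a b => exact (switch_adj hs).mpr (Or.inl ⟨hfG, hf1, hf2⟩)
  · rintro ⟨G, u, v⟩ hq ⟨G', u', v'⟩ hq' heq
    simp only [P, Finset.coe_sigma, Set.mem_sigma_iff, Finset.mem_coe,
      Finset.mem_filter, Finset.mem_univ, true_and] at hq hq'
    simp only [Sigma.mk.injEq, heq_eq_eq, Prod.mk.injEq] at heq
    obtain ⟨h, rfl, rfl⟩ := heq
    have : G = G' := by rw [← switch_switch hq.2.1, h, switch_switch hq'.2.1]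
    rw [this]

theorem card_regularGraphsContaining_le {d n : ℕ} (hd : 0 < d) (hn : 0 < n)
    (H : Finset (Sym2 (Fin n))) (hH : 4 * H.card + 4 * ((d + 2) * d) ≤ n * d) :
    ((regularGraphsContaining d n H).card : ℝ) ≤
      (2 * d / n) ^ H.card * (regularGraphs d n).card := by
  classical
  induction H using Finset.induction_on with
  | empty => simp [regularGraphsContaining]
  | insert e H he ih =>
    rw [Finset.card_insert_of_notMem he] at hH ⊢
    have h1 := card_regularGraphsContaining_insert (d := d) he
    have h2 := ih (by omega)
    -- The size condition on `H` keeps at least half of the oriented edges available, so each new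
    -- edge costs a factor `d² / (n d / 2) = 2 d / n`.
    have h3 : n * d ≤ 2 * (n * d - (2 * H.card + 2 * ((d + 2) * d))) := by omega
    have h4 : (regularGraphsContaining d n (insert e H)).card * (n * d) ≤
        (regularGraphsContaining d n H).card * (2 * (d * d)) := by nlinarith
    have h5 : ((regularGraphsContaining d n (insert e H)).card : ℝ) * (n * d) ≤
        (regularGraphsContaining d n H).card * (2 * (d * d)) := by exact_mod_cast h4
    have hn' : (0 : ℝ) < n := by exact_mod_cast hn
    have hd' : (0 : ℝ) < d := by exact_mod_cast hd
    calc ((regularGraphsContaining d n (insert e H)).card : ℝ)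
        ≤ (regularGraphsContaining d n H).card * (2 * (d * d)) / (n * d) := by
          rwa [le_div_iff₀ (by positivity)]
      _ = (2 * d / n) * (regularGraphsContaining d n H).card := by field_simp
      _ ≤ (2 * d / n) * ((2 * d / n) ^ H.card * (regularGraphs d n).card) :=
          mul_le_mul_of_nonneg_left h2 (by positivity)
      _ = _ := by ring

/-! ### Existence of regular graphs -/

/-- Take `±1, …, ±⌊d/2⌋`, together with the self-inverse `n / 2` when `d` is odd, which forces `n`
even. -/
theorem exists_symmetric_finset {d n : ℕ} [NeZero n] (hdn : d < n) (h : Even (n * d)) :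
    ∃ S : Finset (Fin n), S.card = d ∧ 0 ∉ S ∧ ∀ x ∈ S, -x ∈ S := by
  let T : Finset ℕ := (Finset.range n).filter fun i =>
    (1 ≤ i ∧ i ≤ d / 2) ∨ n - d / 2 ≤ i ∨ (Odd d ∧ 2 * i = n)
  refine ⟨T.attachFin fun i hi => by simp [T] at hi; exact hi.1, ?_, ?_, ?_⟩
  · rw [Finset.card_attachFin]
    rcases Nat.even_or_odd d with hd | hd
    · have hT : T = Finset.Icc 1 (d / 2) ∪ Finset.Ico (n - d / 2) n := by
        ext i
        have : ¬ Odd d := by simpa using hd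
        simp only [T, this, Finset.mem_filter, Finset.mem_range, Finset.mem_union, Finset.mem_Icc,
          Finset.mem_Ico, false_and, or_false]
        omega
      obtain ⟨m, rfl⟩ := hd
      rw [hT, Finset.card_union_of_disjoint, Nat.card_Icc, Nat.card_Ico]
      · omega
      · rw [Finset.disjoint_left]
        intro i
        simp only [Finset.mem_Icc, Finset.mem_Ico]
        omega
    · have hn : Even n := (Nat.even_mul.mp h).resolve_right (by simpa using hd)
      obtain ⟨p, rfl⟩ := hn
      have hT : T = insert p (Finset.Icc 1 (d / 2) ∪ Finset.Ico (p + p - d / 2) (p + p)) := by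
        ext i
        simp only [T, hd, Finset.mem_filter, Finset.mem_range, Finset.mem_union, Finset.mem_Icc,
          Finset.mem_Ico, Finset.mem_insert, true_and]
        omega
      obtain ⟨m, rfl⟩ := hd
      rw [hT, Finset.card_insert_of_notMem, Finset.card_union_of_disjoint, Nat.card_Icc,
        Nat.card_Ico]
      · omega
      · rw [Finset.disjoint_left]
        intro i
        simp only [Finset.mem_Icc, Finset.mem_Ico]
        omega
      · simp only [Finset.mem_union, Finset.mem_Icc, Finset.mem_Ico]
        omega
  · have := NeZero.pos n
    simp only [T, Finset.mem_attachFin, Finset.mem_filter, Finset.mem_range, Fin.val_zero]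
    omega
  · intro x hx
    have hxn := x.isLt
    simp only [T, Finset.mem_attachFin, Finset.mem_filter, Finset.mem_range] at hx ⊢
    have hx0 : 0 < x.val := by omega
    have hneg : (-x).val = n - x.val := by
      rw [Fin.val_neg', Nat.mod_eq_of_lt (by omega)]
    rw [hneg]
    rcases hx.2 with h | h | h
    · omega
    · omega
    · refine ⟨by omega, Or.inr (Or.inr ⟨h.1, by omega⟩)⟩

/-- A circulant graph. Without nonemptiness `regularGraphProb` would be `0 / 0 = 0`. -/
theorem regularGraphs_nonempty {d n : ℕ} (hdn : d < n) (h : Even (n * d)) :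
    (regularGraphs d n).Nonempty := by
  classical
  have : NeZero n := ⟨by omega⟩
  obtain ⟨S, hcard, h0, hneg⟩ := exists_symmetric_finset hdn h
  let G : SimpleGraph (Fin n) :=
    { Adj := fun u v => v - u ∈ S
      symm := ⟨fun u v huv => by simpa using hneg _ huv⟩
      loopless := ⟨fun u hu => h0 (by simpa using hu)⟩ }
  refine ⟨G, ?_⟩
  simp only [regularGraphs, Finset.mem_filter, Finset.mem_univ, true_and]
  intro u
  rw [← SimpleGraph.card_neighborFinset_eq_degree, ← hcard]
  refine Finset.card_nbij' (fun v => v - u) (fun w => w + u) ?_ ?_ ?_ ?_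
  · intro v hv
    simpa [G] using hv
  · intro w hw
    simpa [G] using hw
  · intro v _
    simp
  · intro w _
    simp

/-! ### Small sets of a random regular graph are sparse -/

theorem ncard_edgeSet_of_mem_regularGraphs {d n : ℕ} {G : SimpleGraph (Fin n)}
    (hG : G ∈ regularGraphs d n) : (G.edgeSet.ncard : ℝ) = n * d / 2 := by
  classical
  have h : G.IsRegularOfDegree d := by simpa [regularGraphs] using hG
  have h1 := G.sum_degrees_eq_twice_card_edges
  rw [Finset.sum_congr rfl fun v _ => h v, Finset.sum_const, Finset.card_univ, Fintype.card_fin,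
    smul_eq_mul, ← Set.ncard_coe_finset, SimpleGraph.coe_edgeFinset] at h1
  rw [eq_div_iff two_ne_zero, mul_comm]
  exact_mod_cast h1.symm

theorem regularGraphProb_le_one (d n : ℕ) (P : SimpleGraph (Fin n) → Prop) :
    regularGraphProb d n P ≤ 1 := by
  classical
  exact div_le_one_of_le₀ (by exact_mod_cast Finset.card_filter_le _ _) (Nat.cast_nonneg _)

theorem regularGraphProb_mono {d n : ℕ} {P Q : SimpleGraph (Fin n) → Prop}
    (h : ∀ G ∈ regularGraphs d n, P G → Q G) :
    regularGraphProb d n P ≤ regularGraphProb d n Q := by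
  classical
  refine div_le_div_of_nonneg_right ?_ (Nat.cast_nonneg _)
  norm_cast
  refine Finset.card_le_card fun G hG => ?_
  rw [Finset.mem_filter] at hG ⊢
  exact ⟨hG.1, h G hG.1 hG.2⟩

theorem tendsto_regularGraphProb_of_imp {d : ℕ} {P Q : ∀ n, SimpleGraph (Fin n) → Prop}
    (hP : Tendsto (fun n => regularGraphProb d n (P n)) (atTopEven d) (𝓝 1))
    (h : ∀ᶠ n in atTopEven d, ∀ G ∈ regularGraphs d n, P n G → Q n G) :
    Tendsto (fun n => regularGraphProb d n (Q n)) (atTopEven d) (𝓝 1) :=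
  tendsto_of_tendsto_of_tendsto_of_le_of_le' hP tendsto_const_nhds
    (h.mono fun _ hn => regularGraphProb_mono hn)
    (Eventually.of_forall fun _ => regularGraphProb_le_one _ _ _)

/-- One term of the union bound: `k` vertices, `h` of at most `k²` pairs, and the probability of
those edges. The powers of `k` and `n` combine to `(k / n) ^ (h - k)`; the rest is exponential in
`k`, both binomials being bounded through `k ^ j / j! ≤ exp k`. -/
theorem choose_mul_choose_mul_pow_le {d n k h M : ℕ} (hd : 0 < d) (hn : 0 < n) (hk : 0 < k)
    (hkh : k ≤ h) (hM : h ≤ M * k) :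
    (n.choose k : ℝ) * ((k ^ 2).choose h : ℝ) * (2 * d / n) ^ h ≤
      (Real.exp 2 * (2 * d) ^ M) ^ k * (k / n : ℝ) ^ (h - k) := by
  have hn' : (0 : ℝ) < n := by exact_mod_cast hn
  have hk' : (0 : ℝ) < k := by exact_mod_cast hk
  have hd' : (1 : ℝ) ≤ d := by exact_mod_cast hd
  have h1 : (n.choose k : ℝ) ≤ n ^ k / k ^ k * Real.exp k := by
    refine (Nat.choose_le_pow_div k n).trans ?_
    have := Real.pow_div_factorial_le_exp (k : ℝ) hk'.le k
    rw [div_mul_eq_mul_div, div_le_div_iff₀ (by positivity) (by positivity)]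
    rw [div_le_iff₀ (by positivity)] at this
    calc (n : ℝ) ^ k * k ^ k ≤ n ^ k * (Real.exp k * k.factorial) :=
          mul_le_mul_of_nonneg_left this (by positivity)
      _ = _ := by ring
  have h2 : ((k ^ 2).choose h : ℝ) ≤ k ^ h * Real.exp k := by
    refine (Nat.choose_le_pow_div h (k ^ 2)).trans ?_
    have := Real.pow_div_factorial_le_exp (k : ℝ) hk'.le h
    calc (((k ^ 2 : ℕ) : ℝ)) ^ h / h.factorial = k ^ h * (k ^ h / h.factorial) := by
          push_cast; ring
      _ ≤ _ := mul_le_mul_of_nonneg_left this (by positivity)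
  have h3 : (2 * d : ℝ) ^ h ≤ (2 * d : ℝ) ^ (M * k) :=
    pow_le_pow_right₀ (by linarith) hM
  calc (n.choose k : ℝ) * ((k ^ 2).choose h : ℝ) * (2 * d / n) ^ h
      ≤ (n ^ k / k ^ k * Real.exp k) * (k ^ h * Real.exp k) * (2 * d / n) ^ h := by gcongr
    _ = Real.exp k * Real.exp k * (2 * d) ^ h * (k / n : ℝ) ^ (h - k) := by
        obtain ⟨j, rfl⟩ := Nat.exists_eq_add_of_le hkh
        rw [Nat.add_sub_cancel_left, div_pow, div_pow, pow_add (k : ℝ), pow_add (n : ℝ)]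
        field_simp
    _ ≤ Real.exp k * Real.exp k * (2 * d) ^ (M * k) * (k / n : ℝ) ^ (h - k) := by gcongr
    _ = _ := by
        have hexp : Real.exp 2 ^ k = Real.exp k * Real.exp k := by
          rw [← Real.exp_nat_mul, ← Real.exp_add, mul_two]
        rw [mul_pow (Real.exp 2), hexp, ← pow_mul]

open Classical in
-- A violating set of size `k` spans at least `h k` edges; fixing exactly `h k` of them gives a
-- union bound over vertex sets and edge sets.
theorem card_not_smallSetsSparse_le (d n : ℕ) {η ε : ℝ} (h : ℕ → ℕ)
    (hh : ∀ k j : ℕ, (1 + ε) * k < j → h k ≤ j) :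
    ((regularGraphs d n).filter fun G => ¬ SmallSetsSparse G η ε).card ≤
      ∑ k ∈ (Finset.range (n + 1)).filter (fun k : ℕ => (k : ℝ) ≤ η * n),
        ∑ K ∈ Finset.powersetCard k (Finset.univ : Finset (Fin n)),
          ∑ H ∈ Finset.powersetCard (h k) K.sym2, (regularGraphsContaining d n H).card := by
  refine (Finset.card_le_card (t := Finset.biUnion _ fun k => Finset.biUnion _ fun K =>
    Finset.biUnion _ fun H => regularGraphsContaining d n H) fun G hG => ?_).trans <|
    Finset.card_biUnion_le.trans <| Finset.sum_le_sum fun k _ =>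
    Finset.card_biUnion_le.trans <| Finset.sum_le_sum fun K _ => Finset.card_biUnion_le
  rw [Finset.mem_filter, SmallSetsSparse] at hG
  obtain ⟨hR, hG⟩ := hG
  push Not at hG
  obtain ⟨K, hK, hspan⟩ := hG
  rw [Fintype.card_fin] at hK
  have hle := hh _ _ hspan
  have heq : {e : Sym2 (Fin n) | e ∈ G.edgeSet ∧ ∀ x ∈ e, x ∈ K} =
      ((Finset.univ.filter fun e => e ∈ G.edgeSet ∧ ∀ x ∈ e, x ∈ K : Finset (Sym2 (Fin n))) :
        Set (Sym2 (Fin n))) := by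
    ext e
    simp
  rw [spannedEdges, heq, Set.ncard_coe_finset] at hle
  obtain ⟨H, hH, hHcard⟩ := Finset.exists_subset_card_eq hle
  simp only [Finset.mem_biUnion]
  refine ⟨K.card, ?_, K, ?_, H, ?_, ?_⟩
  · rw [Finset.mem_filter, Finset.mem_range]
    exact ⟨Nat.lt_succ_of_le (by simpa using Finset.card_le_univ K), hK⟩
  · simp [Finset.mem_powersetCard]
  · rw [Finset.mem_powersetCard]
    refine ⟨fun e he => ?_, hHcard⟩
    have := hH he
    rw [Finset.mem_filter] at this
    rw [Finset.mem_sym2_iff]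
    exact this.2.2
  · rw [regularGraphsContaining, Finset.mem_filter]
    refine ⟨hR, fun e he => ?_⟩
    have := hH he
    rw [Finset.mem_filter] at this
    exact this.2.1

/-- For each `k`, the number of edges which makes a `k`-set violate sparsity. -/
def excess (ε : ℝ) (k : ℕ) : ℕ := ⌊(1 + ε) * k⌋₊ + 1

theorem excess_le {ε : ℝ} (hε : 0 < ε) {k : ℕ} (hk : 0 < k) :
    excess ε k ≤ ⌈2 + ε⌉₊ * k := by
  have h1 : ((⌊(1 + ε) * k⌋₊ : ℕ) : ℝ) ≤ (1 + ε) * k := Nat.floor_le (by positivity)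
  have h2 : (2 + ε : ℝ) ≤ ⌈2 + ε⌉₊ := Nat.le_ceil _
  have hk' : (1 : ℝ) ≤ k := by exact_mod_cast hk
  have h3 : ((excess ε k : ℕ) : ℝ) ≤ ⌈2 + ε⌉₊ * k := by
    rw [excess]
    push_cast
    nlinarith
  exact_mod_cast h3

theorem lt_excess (ε : ℝ) (k : ℕ) : (1 + ε) * k < excess ε k := by
  rw [excess]
  push_cast
  exact Nat.lt_floor_add_one _

theorem le_excess {ε : ℝ} (hε : 0 < ε) (k : ℕ) : k < excess ε k := by
  have h := lt_excess ε k
  have : (k : ℝ) < excess ε k := lt_of_le_of_lt (by nlinarith [Nat.cast_nonneg (α := ℝ) k]) h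
  exact_mod_cast this

open Classical in
theorem card_not_smallSetsSparse_le_sum {d n : ℕ} {η ε : ℝ} (hε : 0 < ε) (hd : 0 < d)
    (hη : η * (8 * ⌈2 + ε⌉₊) ≤ 1) (hn : 8 * (d + 2) ≤ n) :
    ((((regularGraphs d n).filter fun G => ¬ SmallSetsSparse G η ε).card : ℕ) : ℝ) ≤
      (∑ k ∈ (Finset.range (n + 1)).filter (fun k : ℕ => (k : ℝ) ≤ η * n),
        (Real.exp 2 * (2 * d) ^ ⌈2 + ε⌉₊) ^ k * (k / n : ℝ) ^ (excess ε k - k)) *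
        (regularGraphs d n).card := by
  classical
  have hn0 : 0 < n := by omega
  have hn' : (0 : ℝ) < n := by exact_mod_cast hn0
  have h1 := card_not_smallSetsSparse_le d n (η := η) (ε := ε) (excess ε) (fun k j hj => by
    rw [excess, Nat.succ_le_iff]
    have := Nat.floor_le (a := (1 + ε) * k) (by positivity)
    have h2 : ((⌊(1 + ε) * k⌋₊ : ℕ) : ℝ) < j := this.trans_lt hj
    exact_mod_cast h2)
  have h2 : ((((regularGraphs d n).filter fun G => ¬ SmallSetsSparse G η ε).card : ℕ) : ℝ) ≤
      ∑ k ∈ (Finset.range (n + 1)).filter (fun k : ℕ => (k : ℝ) ≤ η * n),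
        ∑ K ∈ Finset.powersetCard k (Finset.univ : Finset (Fin n)),
          ∑ H ∈ Finset.powersetCard (excess ε k) K.sym2,
            ((regularGraphsContaining d n H).card : ℝ) := by
    exact_mod_cast h1
  refine h2.trans ?_
  rw [Finset.sum_mul]
  refine Finset.sum_le_sum fun k hk => ?_
  rw [Finset.mem_filter] at hk
  rcases Nat.eq_zero_or_pos k with rfl | hk0
  · have hempty : Finset.powersetCard 1 (∅ : Finset (Sym2 (Fin n))) = ∅ :=
      Finset.powersetCard_eq_empty.mpr (by simp)
    simp [excess, hempty]
  have hM := excess_le hε hk0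
  -- The bounds `8 ⌈2 + ε⌉ k ≤ n` and `8 (d + 2) ≤ n` each account for half of `n * d`.
  have hcond : 4 * excess ε k + 4 * ((d + 2) * d) ≤ n * d := by
    have h8 : 8 * (⌈2 + ε⌉₊ * k) ≤ n := by
      have : (8 * (⌈2 + ε⌉₊ * k) : ℝ) ≤ n := by
        calc (8 * (⌈2 + ε⌉₊ * k) : ℝ) ≤ 8 * (⌈2 + ε⌉₊ * (η * n)) := by gcongr; exact hk.2
          _ = (η * (8 * ⌈2 + ε⌉₊)) * n := by ring
          _ ≤ 1 * n := by gcongr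
          _ = n := one_mul _
      exact_mod_cast this
    have h9 : 8 * (d + 2) * d ≤ n * d := Nat.mul_le_mul_right _ hn
    have h10 : n ≤ n * d := Nat.le_mul_of_pos_right _ hd
    have h11 : 8 * (d + 2) * d = 8 * ((d + 2) * d) := by ring
    omega
  have hinner : ∀ K ∈ Finset.powersetCard k (Finset.univ : Finset (Fin n)),
      ∑ H ∈ Finset.powersetCard (excess ε k) K.sym2, ((regularGraphsContaining d n H).card : ℝ) ≤
      ((k ^ 2).choose (excess ε k) : ℝ) *
        ((2 * d / n) ^ excess ε k * (regularGraphs d n).card) := by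
    intro K hK
    rw [Finset.mem_powersetCard] at hK
    calc _ ≤ ∑ H ∈ Finset.powersetCard (excess ε k) K.sym2,
          ((2 * d / n : ℝ) ^ excess ε k * (regularGraphs d n).card) := by
          refine Finset.sum_le_sum fun H hH => ?_
          rw [Finset.mem_powersetCard] at hH
          have := card_regularGraphsContaining_le hd hn0 H (by rw [hH.2]; exact hcond)
          rwa [hH.2] at this
      _ = (K.sym2.card.choose (excess ε k) : ℝ) *
          ((2 * d / n : ℝ) ^ excess ε k * (regularGraphs d n).card) := by
          rw [Finset.sum_const, Finset.card_powersetCard, nsmul_eq_mul]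
      _ ≤ _ := by
          gcongr
          rw [Finset.card_sym2, hK.2, Nat.choose_two_right, Nat.add_sub_cancel]
          refine Nat.div_le_of_le_mul ?_
          nlinarith
  calc _ ≤ ∑ K ∈ Finset.powersetCard k (Finset.univ : Finset (Fin n)),
        ((k ^ 2).choose (excess ε k) : ℝ) *
          ((2 * d / n) ^ excess ε k * (regularGraphs d n).card) := Finset.sum_le_sum hinner
    _ = (n.choose k : ℝ) * ((k ^ 2).choose (excess ε k) : ℝ) * (2 * d / n) ^ excess ε k *
          (regularGraphs d n).card := by
        rw [Finset.sum_const, Finset.card_powersetCard, nsmul_eq_mul, Finset.card_univ,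
          Fintype.card_fin]
        ring
    _ ≤ _ := mul_le_mul_of_nonneg_right
        (choose_mul_choose_mul_pow_le hd hn0 hk0 (le_excess hε k).le hM) (Nat.cast_nonneg _)

/-- Dominated convergence: each term vanishes because its exponent is at least `1`. Since the
exponent exceeds `ε k ≥ k / q` for `k > 0`, the choice `η = ρ ^ q` bounds the term by `(C ρ) ^ k ≤ 2
^ (-k)`. -/
theorem tendsto_sum_excess {C η ε : ℝ} (hε : 0 < ε) (hC : 0 ≤ C) (hη : 0 ≤ η) {q : ℕ} {ρ : ℝ}
    (hρ : 0 ≤ ρ) (hρ1 : ρ ≤ 1) (hq : 1 ≤ q * ε) (hηρ : η = ρ ^ q) (hCρ : C * ρ ≤ 1 / 2) :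
    Tendsto (fun n : ℕ => ∑ k ∈ (Finset.range (n + 1)).filter (fun k : ℕ => (k : ℝ) ≤ η * n),
      C ^ k * (k / n : ℝ) ^ (excess ε k - k)) atTop (𝓝 0) := by
  let f : ℕ → ℕ → ℝ := fun n k =>
    if k ∈ (Finset.range (n + 1)).filter (fun k : ℕ => (k : ℝ) ≤ η * n) then
      C ^ k * (k / n : ℝ) ^ (excess ε k - k) else 0
  have hf : ∀ n, ∑ k ∈ (Finset.range (n + 1)).filter (fun k : ℕ => (k : ℝ) ≤ η * n),
      C ^ k * (k / n : ℝ) ^ (excess ε k - k) = ∑' k, f n k := by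
    intro n
    rw [tsum_eq_sum (s := (Finset.range (n + 1)).filter (fun k : ℕ => (k : ℝ) ≤ η * n))]
    · exact Finset.sum_congr rfl fun k hk => (if_pos hk).symm
    · intro k hk
      exact if_neg hk
  have hη1 : η ≤ 1 := hηρ ▸ pow_le_one₀ hρ hρ1
  have hratio : ∀ n k : ℕ, (k : ℝ) ≤ η * n → (k / n : ℝ) ≤ η := by
    intro n k hk
    rcases Nat.eq_zero_or_pos n with rfl | hn
    · simpa using hη
    · rwa [div_le_iff₀ (by exact_mod_cast hn)]
  simp only [hf]
  rw [show (0 : ℝ) = ∑' _ : ℕ, (0 : ℝ) by simp]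
  refine tendsto_tsum_of_dominated_convergence (bound := fun k => (1 / 2 : ℝ) ^ k)
    (summable_geometric_of_lt_one (by norm_num) (by norm_num)) (fun k => ?_)
    (Eventually.of_forall fun n k => ?_)
  · have hlim : Tendsto (fun n : ℕ => C ^ k * (k / n : ℝ)) atTop (𝓝 0) := by
      simpa using (tendsto_const_div_atTop_nhds_zero_nat (k : ℝ)).const_mul (C ^ k)
    refine squeeze_zero (fun n => ?_) (fun n => ?_) hlim
    · simp only [f]
      split_ifs <;> positivity
    · simp only [f]
      split_ifs with hk
      · rw [Finset.mem_filter] at hk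
        refine mul_le_mul_of_nonneg_left ?_ (by positivity)
        refine pow_le_of_le_one (by positivity) ((hratio n k hk.2).trans hη1) ?_
        have := le_excess hε k
        omega
      · positivity
  · simp only [f]
    split_ifs with hk
    · rw [Finset.mem_filter] at hk
      rw [Real.norm_of_nonneg (by positivity)]
      have hle : k ≤ q * (excess ε k - k) := by
        have h1 := lt_excess ε k
        have h2 := (le_excess hε k).le
        have h3 : (k : ℝ) ≤ q * ((excess ε k : ℝ) - k) := by
          have hk0 : (0 : ℝ) ≤ k := Nat.cast_nonneg k
          calc (k : ℝ) = 1 * k := (one_mul _).symm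
            _ ≤ (q * ε) * k := by gcongr
            _ = q * (ε * k) := by ring
            _ ≤ _ := mul_le_mul_of_nonneg_left (by linarith) (Nat.cast_nonneg q)
        have h4 : (k : ℝ) ≤ ((q * (excess ε k - k) : ℕ) : ℝ) := by
          push_cast [h2]
          exact h3
        exact_mod_cast h4
      calc C ^ k * (k / n : ℝ) ^ (excess ε k - k) ≤ C ^ k * η ^ (excess ε k - k) := by
            gcongr
            exact hratio n k hk.2
        _ ≤ C ^ k * ρ ^ k := by
            rw [hηρ, ← pow_mul]
            exact mul_le_mul_of_nonneg_left (pow_le_pow_of_le_one hρ hρ1 hle) (by positivity)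
        _ = (C * ρ) ^ k := (mul_pow _ _ _).symm
        _ ≤ _ := pow_le_pow_left₀ (by positivity) hCρ k
    · simp

theorem exists_tendsto_smallSetsSparse {d : ℕ} (hd : 0 < d) {ε : ℝ} (hε : 0 < ε) :
    ∃ η : ℝ, 0 < η ∧ Tendsto (fun n => regularGraphProb d n fun G => SmallSetsSparse G η ε)
      (atTopEven d) (𝓝 1) := by
  classical
  set M : ℕ := ⌈2 + ε⌉₊ with hMdef
  have hM : 1 ≤ M := Nat.one_le_ceil_iff.mpr (by linarith)
  have hM' : (1 : ℝ) ≤ M := by exact_mod_cast hM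
  have hd' : (1 : ℝ) ≤ d := by exact_mod_cast hd
  set C : ℝ := Real.exp 2 * (2 * d) ^ M with hC
  have hC1 : 1 ≤ C := one_le_mul_of_one_le_of_one_le (Real.one_le_exp (by norm_num))
    (one_le_pow₀ (by linarith))
  -- Small enough for both `C ρ ≤ 1/2` (domination) and `8 M ρ ≤ 1` (the size condition for
  -- switchings).
  set ρ : ℝ := 1 / (8 * M * C) with hρdef
  have hMC : 1 ≤ M * C := one_le_mul_of_one_le_of_one_le hM' hC1
  have hρ : 0 < ρ := by positivity
  have hρM : ρ * (8 * M) ≤ 1 := by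
    rw [hρdef, div_mul_eq_mul_div, div_le_one (by positivity)]
    nlinarith
  have hCρ : C * ρ ≤ 1 / 2 := by
    rw [hρdef, mul_one_div, div_le_div_iff₀ (by positivity) (by norm_num)]
    nlinarith
  have hρ1 : ρ ≤ 1 := by nlinarith
  obtain ⟨q, hq⟩ := exists_nat_ge (1 / ε)
  have hq' : 1 ≤ q * ε := by rwa [div_le_iff₀ hε] at hq
  have hq0 : q ≠ 0 := by
    rintro rfl
    norm_num at hq'
  have hηM : ρ ^ q * (8 * M) ≤ 1 :=
    (mul_le_mul_of_nonneg_right (pow_le_of_le_one hρ.le hρ1 hq0) (by positivity)).trans hρM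
  refine ⟨ρ ^ q, by positivity, ?_⟩
  have hsum := tendsto_sum_excess (C := C) hε (by linarith) (pow_nonneg hρ.le q) hρ.le hρ1 hq'
    rfl hCρ
  have hlow := (hsum.const_sub 1).mono_left (inf_le_left : atTopEven d ≤ atTop)
  rw [sub_zero] at hlow
  refine tendsto_of_tendsto_of_tendsto_of_le_of_le' hlow tendsto_const_nhds ?_
    (Eventually.of_forall fun _ => regularGraphProb_le_one _ _ _)
  have hlarge : ∀ᶠ n in atTopEven d, 8 * (d + 2) ≤ n :=
    (eventually_ge_atTop _).filter_mono inf_le_left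
  have heven : ∀ᶠ n in atTopEven d, Even (n * d) := mem_inf_of_right (mem_principal_self _)
  filter_upwards [hlarge, heven] with n hn hne
  have hR : 0 < ((regularGraphs d n).card : ℝ) := by
    exact_mod_cast Finset.card_pos.mpr (regularGraphs_nonempty (by omega) hne)
  have hbad := card_not_smallSetsSparse_le_sum hε hd hηM hn
  have hsplit := Finset.card_filter_add_card_filter_not (s := regularGraphs d n)
    (fun G => SmallSetsSparse G (ρ ^ q) ε)
  have hsplit' : (((regularGraphs d n).filter fun G => SmallSetsSparse G (ρ ^ q) ε).card : ℝ) +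
      ((regularGraphs d n).filter fun G => ¬ SmallSetsSparse G (ρ ^ q) ε).card =
      (regularGraphs d n).card := by exact_mod_cast hsplit
  rw [regularGraphProb, le_div_iff₀ hR, sub_mul, one_mul, sub_le_iff_le_add]
  refine hsplit'.symm.le.trans (add_le_add (le_of_eq ?_) hbad)
  congr!

end Interchange

end

/-! ### The critical time and the conclusion -/

/-- The origin of `T`: it is the time in which a gain at rate `d/2 - (1 + θ)` per vertex pays the
entropy cost. -/
theorem Interchange.criticalTime_mul {θ : ℝ} {d : ℕ} (hd : 2 * (1 + θ) < (d : ℝ)) :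
    criticalTime θ d * ((d : ℝ) / 2 - (1 + θ)) = entropyCost θ := by
  rw [criticalTime, entropyCost]
  split_ifs with h
  · subst h
    have : (d : ℝ) - 4 ≠ 0 := by linarith
    field_simp
    ring
  · have h1 : (d : ℝ) - 2 * (1 + θ) ≠ 0 := by linarith
    have h2 : θ - 1 ≠ 0 := sub_ne_zero.mpr h
    field_simp

theorem Interchange.criticalTime_nonneg {θ : ℝ} (hθ : 0 < θ) {d : ℕ}
    (hd : 2 * (1 + θ) < (d : ℝ)) : 0 ≤ criticalTime θ d := by
  have hκ : 0 ≤ entropyCost θ := by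
    rw [entropyCost]
    split_ifs with h
    · exact zero_le_one
    · rcases lt_or_gt_of_ne h with h | h
      · exact div_nonneg_of_nonpos (mul_nonpos_of_nonneg_of_nonpos hθ.le
          (Real.log_nonpos hθ.le h.le)) (by linarith)
      · exact div_nonneg (mul_nonneg hθ.le (Real.log_nonneg h.le)) (by linarith)
  rw [← criticalTime_mul hd] at hκ
  exact nonneg_of_mul_nonneg_left hκ (by linarith)

theorem Interchange.le_integral_prob_of_mem_regularGraphs {θ : ℝ} (hθ : 0 < θ) {d n : ℕ}
    (hn : 0 < n) (hd : 2 * (1 + θ) < (d : ℝ)) {ε : ℝ} (hε : ε < ((d : ℝ) - 2) / 2) {η : ℝ}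
    {G : SimpleGraph (Fin n)} (hG : G ∈ regularGraphs d n) (hs : SmallSetsSparse G η ε) {a b : ℝ}
    (ha : 0 ≤ a) (hab : a ≤ b) :
    ((b - a) * ((d : ℝ) / 2 - (θ + 1) * (1 + ε)) - criticalTime θ d * ((d : ℝ) / 2 - (1 + θ)))
        / ((1 + θ) * ((d : ℝ) / 2 - (1 + ε))) ≤
      ∫ t in a..b, prob G θ t (HasMacroscopicCycle η) := by
  have h := le_integral_prob G hθ hs ha hab
  rw [ncard_edgeSet_of_mem_regularGraphs hG, Fintype.card_fin, ← criticalTime_mul hd] at h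
  have hn' : (0 : ℝ) < n := by exact_mod_cast hn
  rw [div_le_iff₀ (mul_pos (by linarith) (by linarith))]
  refine le_of_mul_le_mul_left ?_ hn'
  linear_combination h

theorem theorem2 (θ : ℝ) (hθ : 0 < θ) (d : ℕ) (hd : 2 * (1 + θ) < (d : ℝ)) :
    (∀ ε : ℝ, 0 < ε → ε < ((d : ℝ) - 2) / 2 →
      ∃ η : ℝ, 0 < η ∧ ∀ a b : ℝ, 0 ≤ a → a ≤ b →
        Tendsto
          (fun n : ℕ => Interchange.regularGraphProb d n fun G =>
            ((b - a) * ((d : ℝ) / 2 - (θ + 1) * (1 + ε))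
                - Interchange.criticalTime θ d * ((d : ℝ) / 2 - (1 + θ)))
              / ((1 + θ) * ((d : ℝ) / 2 - (1 + ε)))
            ≤ ∫ t in a..b, Interchange.prob G θ t (Interchange.HasMacroscopicCycle η))
          (Interchange.atTopEven d) (𝓝 1)) ∧
    (∀ δ : ℝ, 0 < δ →
      ∃ η c : ℝ, 0 < η ∧ 0 < c ∧ ∀ a : ℝ, 0 ≤ a →
        Tendsto
          (fun n : ℕ => Interchange.regularGraphProb d n fun G =>
            ∃ t ∈ Set.Icc a (a + Interchange.criticalTime θ d + δ),
              c ≤ Interchange.prob G θ t (Interchange.HasMacroscopicCycle η))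
          (Interchange.atTopEven d) (𝓝 1)) := by
  have hd0 : 0 < d := by
    have : (0 : ℝ) < d := by linarith
    exact_mod_cast this
  have hpos : ∀ᶠ n in Interchange.atTopEven d, 0 < n :=
    (eventually_gt_atTop 0).filter_mono inf_le_left
  constructor
  · intro ε hε0 hε
    obtain ⟨η, hη, hlim⟩ := Interchange.exists_tendsto_smallSetsSparse hd0 hε0
    refine ⟨η, hη, fun a b ha hab => Interchange.tendsto_regularGraphProb_of_imp hlim ?_⟩
    filter_upwards [hpos] with n hn G hG hs
    exact Interchange.le_integral_prob_of_mem_regularGraphs hθ hn hd hε hG hs ha hab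
  · intro δ hδ
    have hT := Interchange.criticalTime_nonneg hθ hd
    set T := Interchange.criticalTime θ d with hTdef
    set D : ℝ := (d : ℝ) / 2 - (1 + θ) with hD
    have hD0 : 0 < D := by linarith
    have hS : 0 < T + δ := by linarith
    -- On an interval of length `T + δ` the numerator in (i) is `δ D - ε (T + δ) (1 + θ)`. The first
    -- entry keeps it at least `δ D / 2`, the second keeps `ε` admissible.
    set ε : ℝ := min (δ * D / (2 * ((T + δ) * (1 + θ)))) (((d : ℝ) - 2) / 4) with hεdef
    have hε0 : 0 < ε := lt_min (by positivity) (by linarith)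
    have hε1 : ε < ((d : ℝ) - 2) / 2 := (min_le_right _ _).trans_lt (by linarith)
    have hε2 : ε * (2 * ((T + δ) * (1 + θ))) ≤ δ * D := by
      rw [← le_div_iff₀ (by positivity)]
      exact min_le_left _ _
    set X : ℝ := ((T + δ) * ((d : ℝ) / 2 - (θ + 1) * (1 + ε)) - T * D)
        / ((1 + θ) * ((d : ℝ) / 2 - (1 + ε))) with hX
    have hX0 : 0 < X := by
      refine div_pos ?_ (mul_pos (by linarith) (by linarith))
      have h1 : 0 < δ * D := by positivity
      have h2 : (T + δ) * ((d : ℝ) / 2 - (θ + 1) * (1 + ε)) - T * D =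
          δ * D - ε * ((T + δ) * (1 + θ)) := by
        rw [hD]
        ring
      linarith
    obtain ⟨η, hη, hlim⟩ := Interchange.exists_tendsto_smallSetsSparse hd0 hε0
    -- Half the mean value guaranteed by (i), independent of `a`: staying below it throughout would
    -- give an integral of at most `X / 2 < X`.
    refine ⟨η, X / (2 * (T + δ)), hη, by positivity, fun a ha =>
      Interchange.tendsto_regularGraphProb_of_imp hlim ?_⟩
    filter_upwards [hpos] with n hn G hG hs
    have hab : a ≤ a + T + δ := by linarith
    have h := Interchange.le_integral_prob_of_mem_regularGraphs hθ hn hd hε1 hG hs ha hab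
    rw [← hTdef, ← hD, show a + T + δ - a = T + δ by ring, ← hX] at h
    by_contra! hcon
    have hle : ∫ t in a..(a + T + δ), Interchange.prob G θ t (Interchange.HasMacroscopicCycle η) ≤
        ∫ _ in a..(a + T + δ), X / (2 * (T + δ)) :=
      intervalIntegral.integral_mono_on hab
        (Interchange.intervalIntegrable_of_continuousOn_Ici
          (Interchange.continuousOn_prob G hθ _) ha hab)
        intervalIntegrable_const fun t ht => (hcon t ht).le
    rw [intervalIntegral.integral_const, smul_eq_mul] at hle
    have hval : (a + T + δ - a) * (X / (2 * (T + δ))) = X / 2 := by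
      rw [show a + T + δ - a = T + δ by ring]
      field_simp
    linarith
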